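/- Let $k$ be an algebraically closed field. A prevariety is an integral $k$-scheme of finite type, and a variety is a separated prevariety. An open subset of a scheme is big if its complement has codimension $>1$. A separation of a prevariety $Y$ is a rational map of $k$-schemes $\mathfrak s:Y\dashrightarrow Y^{\mathrm{sep}}$ with $Y^{\mathrm{sep}}$ separated, which is defined on a big open subset $U\subseteq Y$ such that $\mathfrak s:U\to Y^{\mathrm{sep}}$ is a local isomorphism (every point of $U$ has an open neighbourhood mapped isomorphically onto an open subset) whose image is a big open subset of $Y^{\mathrm{sep}}$. (A) Every normal prevariety $Y$ admits a separation $\mathfrak s:Y\dashrightarrow Y^{\mathrm{sep}}$ with $Y^{\mathrm{sep}}$ a normal variety. Now let $k$ have characteristic $p>0$. For a normal prevariety $X$ and an effective $\mathbb Q$-divisor $\Delta$ on $X$: an $F$-splitting of $X$ is an $\mathcal O_X$-linear map $\sigma:F_*\mathcal O_X\to\mathcal O_X$ with $\sigma\circ F^*=\mathrm{id}$; it is an $F$-splitting of the pair $(X,\Delta)$ if it extends to an $\mathcal O_X$-linear map $F_*(\mathcal O_X(\lceil(p-1)\Delta\rceil))\to\mathcal O_X$; it is compatible with a closed subscheme $S$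 with ideal sheaf $\mathcal I_S$ if $\sigma(F_*\mathcal I_S)\subseteq\mathcal I_S$. The pair $(X,\Delta)$ is $F$-split (compatibly with $S$) if it has an $F$-splitting (compatible with $S$). It is $F$-regular if for every effective Weil divisor $D>0$ there is $e>0$ such that $\mathcal O_X\to F^e_*\mathcal O_X(\lceil(p^e-1)\Delta\rceil+D)$ splits as a map of $\mathcal O_X$-modules. Let $Y$ be a normal prevariety, $\Delta=\sum_P a_P P$ an effective $\mathbb Q$-divisor on $Y$, and $\mathfrak s:Y\dashrightarrow Y^{\mathrm{sep}}$ any separation, defined on the big open subset $U$ as above, with $Y^{\mathrm{sep}}$ a normal variety. Put $$\Delta^{\mathrm{sep}}:=\mathfrak s_{\max}\Delta=\sum_{P'\subset Y^{\mathrm{sep}}}\max\{a_P\mid P\subset\mathfrak s^{-1}(P')\}\cdot P',$$ where $P'$ and $P$ run over prime divisors. (B) $(Y,\Delta)$ is $F$-split if and only if $(Y^{\mathrm{sep}},\Delta^{\mathrm{sep}})$ is $F$-split, and $(Y,\Delta)$ is $F$-regular if and only if $(Y^{\mathrm{sep}},\Delta^{\mathrm{sep}})$ is $F$-regular. (C)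 Let $S\subseteq Y$ be a closed subscheme with $\overline{U\cap S}=S$, and let $\overline{\mathfrak s(S)}$ be the closure of the image of $U\cap S$ in $Y^{\mathrm{sep}}$ (closures are scheme-theoretic). If $(Y,\Delta)$ is $F$-split compatibly with $S$, then $(Y^{\mathrm{sep}},\Delta^{\mathrm{sep}})$ is $F$-split compatibly with $\overline{\mathfrak s(S)}$. The converse holds provided that (i) if $\overline{\mathfrak s(S)}$ is reduced, then so is $S$, and (ii) there are no two irreducible components $C,C'$ of $U\cap S$ such that $\overline{\mathfrak s(C)}$ is properly contained in $\overline{\mathfrak s(C')}$. (For example, (i) and (ii) hold if $S$ is irreducible, or if $\mathfrak s$ is injective on $U$.) -/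

import Mathlib

open CategoryTheory AlgebraicGeometry Order

universe u

namespace FSep

noncomputable section

/-- A scheme is normal if all its local rings are integrally closed domains.  (On an integral
scheme the local rings are automatically domains.) -/
class IsNormal (X : Scheme.{u}) : Prop where
  isDomain_stalk : ∀ x : X, IsDomain (X.presheaf.stalk x)
  isIntegrallyClosed_stalk : ∀ x : X, IsIntegrallyClosed (X.presheaf.stalk x)

/-- A subset of a scheme is big if its complement has codimension `> 1`, i.e. contains no point of
codimension `≤ 1`.  The codimension of the point `x` is `coheight x`, i.e. the dimension of the
local ring at `x`. -/
def IsBig {X : Scheme.{u}} (A : Set X) : Prop :=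
  ∀ x : X, x ∉ A → 1 < coheight x

/-! ### Divisors -/

section Divisors

variable {X : Scheme.{u}}

/-- A Weil divisor with coefficients in `R`: an algebraic cycle (a function on points with locally
finite support, a point standing for its closure) all of whose components are prime divisors. -/
def IsDivisor {R : Type*} [Zero R] (D : AlgebraicCycle X R) : Prop :=
  ∀ x : X, D x ≠ 0 → coheight x = 1

/-- The divisor `⌈c Δ⌉`, for a `ℚ`-divisor `Δ` and a rational number `c`. -/
def ceilMul (c : ℚ) (Δ : AlgebraicCycle X ℚ) : AlgebraicCycle X ℤ where
  toFun x := ⌈c * Δ x⌉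
  supportWithinDomain' := Set.subset_univ _
  supportLocallyFiniteWithinDomain' z hz := by
    obtain ⟨t, ht, hfin⟩ := Δ.supportLocallyFiniteWithinDomain' z hz
    refine ⟨t, ht, hfin.subset ?_⟩
    rintro x ⟨hxt, hx⟩
    refine ⟨hxt, fun h0 => hx ?_⟩
    have h0' : Δ x = 0 := h0
    simp [h0']

/-- The local ring of a normal locally Noetherian scheme at a point of codimension one is a
discrete valuation ring. -/
theorem isDiscreteValuationRing_stalk [IsIntegral X] [IsLocallyNoetherian X] [IsNormal X]
    {x : X} (hx : coheight x = 1) : IsDiscreteValuationRing (X.presheaf.stalk x) := by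
  have h1 : ringKrullDim (X.presheaf.stalk x) = 1 := by
    rw [ringKrullDim_stalk_eq_coheight, hx]; rfl
  have hK : Ring.KrullDimLE 1 (X.presheaf.stalk x) := krullDimLE_of_coheight_le hx.le
  have hnf : ¬ IsField (X.presheaf.stalk x) := by
    intro h
    have := ringKrullDim_eq_zero_of_isField h
    rw [h1] at this
    exact one_ne_zero this
  have hic : IsIntegrallyClosed (X.presheaf.stalk x) := IsNormal.isIntegrallyClosed_stalk x
  have hmax : ∀ P : Ideal (X.presheaf.stalk x), P ≠ ⊥ → P.IsPrime →
      P = IsLocalRing.maximalIdeal (X.presheaf.stalk x) := fun P hP hP' =>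
    IsLocalRing.eq_maximalIdeal (Ideal.IsPrime.isMaximal_of_ne_bot hP' hP)
  have hD : IsDedekindDomain (X.presheaf.stalk x) :=
    ((tfae_of_isNoetherianRing_of_isLocalRing_of_isDomain (X.presheaf.stalk x)).out 2 3).mpr
      (And.intro hic hmax)
  exact ((IsDiscreteValuationRing.TFAE (X.presheaf.stalk x) hnf).out 0 2).mpr hD

variable [IsIntegral X] [IsLocallyNoetherian X] [IsNormal X]

/-- The sections of `𝒪_X(D)` over a nonempty open subset `V`: the rational functions `f` with
`ord_P f ≥ - D(P)` for all prime divisors `P` meeting `V`, as a module over `Γ(X, V)`. -/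
def divisorSections (D : AlgebraicCycle X ℤ) (V : X.Opens) [Nonempty V] :
    Submodule Γ(X, V) X.functionField where
  carrier := {f | f = 0 ∨ ∀ x ∈ V, coheight x = 1 → - D x ≤ Scheme.ord f x}
  zero_mem' := Or.inl rfl
  add_mem' := by
    intro f g hf hg
    by_cases hf0 : f = 0
    · subst hf0; rw [zero_add]; exact hg
    by_cases hg0 : g = 0
    · subst hg0; rw [add_zero]; exact hf
    by_cases hfg : f + g = 0
    · exact Or.inl hfg
    refine Or.inr fun x hxV hx => ?_
    have := isDiscreteValuationRing_stalk hx
    exact (le_min (hf.resolve_left hf0 x hxV hx) (hg.resolve_left hg0 x hxV hx)).trans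
      (Scheme.ord_add hfg)
  smul_mem' := by
    intro a f hf
    by_cases ha : a = 0
    · subst ha; exact Or.inl (zero_smul _ _)
    by_cases hf0 : f = 0
    · subst hf0; exact Or.inl (smul_zero _)
    exact Or.inr fun x hxV hx =>
      (hf.resolve_left hf0 x hxV hx).trans (Scheme.ord_le_smul hxV ha f)

/-- The restriction maps of `𝒪_X(D)` are inclusions inside the function field. -/
theorem divisorSections_mono (D : AlgebraicCycle X ℤ) {V W : X.Opens} [Nonempty V] [Nonempty W]
    (h : V ≤ W) {f : X.functionField} (hf : f ∈ divisorSections D W) :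
    f ∈ divisorSections D V :=
  hf.imp_right fun hf x hx => hf x (h hx)

end Divisors

/-! ### Frobenius splittings -/

section Frobenius

variable (p : ℕ) (X : Scheme.{u})

/-- An `F`-splitting of `X`: a morphism of sheaves of `𝒪_X`-modules `σ : F_* 𝒪_X → 𝒪_X` with
`σ ∘ F^* = id`.  Here `F` is the absolute Frobenius, so `F_* 𝒪_X` is the sheaf of abelian groups
`𝒪_X` on which `f` acts as multiplication by `f ^ p`. -/
structure FSplitting where
  app : ∀ V : X.Opens, Γ(X, V) →+ Γ(X, V)
  app_smul : ∀ (V : X.Opens) (f g : Γ(X, V)), app V (f ^ p * g) = f * app V g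
  app_res : ∀ {V W : X.Opens} (h : V ≤ W) (g : Γ(X, W)),
    X.presheaf.map (homOfLE h).op (app W g) = app V (X.presheaf.map (homOfLE h).op g)
  app_pow : ∀ (V : X.Opens) (f : Γ(X, V)), app V (f ^ p) = f

variable {p X}

/-- An `F`-splitting `σ` is compatible with the closed subscheme defined by the ideal sheaf `I`
if `σ(F_* I) ⊆ I`. -/
def FSplitting.IsCompatible (σ : FSplitting p X) (I : X.IdealSheafData) : Prop :=
  ∀ (V : X.affineOpens) (f : Γ(X, V)), f ∈ I.ideal V → σ.app V f ∈ I.ideal V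

variable [IsIntegral X] [IsLocallyNoetherian X] [IsNormal X]

variable (p) in
/-- A morphism of sheaves of `𝒪_X`-modules `F^e_* (𝒪_X(D)) → 𝒪_X`.  (Nothing needs to be said
about the empty open subset, where `𝒪_X` vanishes.) -/
structure FrobeniusHom (e : ℕ) (D : AlgebraicCycle X ℤ) where
  app : ∀ (V : X.Opens) [Nonempty V], divisorSections D V →+ Γ(X, V)
  app_smul : ∀ (V : X.Opens) [Nonempty V] (f : Γ(X, V)) (g : divisorSections D V),
    app V (f ^ p ^ e • g) = f * app V g
  app_res : ∀ {V W : X.Opens} [Nonempty V] [Nonempty W] (h : V ≤ W) (g : divisorSections D W),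
    X.presheaf.map (homOfLE h).op (app W g) = app V ⟨g, divisorSections_mono D h g.2⟩

/-- An `F`-splitting `σ` is a `D`-splitting, for an effective divisor `D`, if it extends along
`𝒪_X → 𝒪_X(D)` to a morphism `F_* (𝒪_X(D)) → 𝒪_X`. -/
def FSplitting.IsDivisorSplitting (σ : FSplitting p X) (D : AlgebraicCycle X ℤ) : Prop :=
  ∃ φ : FrobeniusHom p 1 D, ∀ (V : X.Opens) [Nonempty V] (f : Γ(X, V)),
    ∃ h : X.germToFunctionField V f ∈ divisorSections D V,
      φ.app V ⟨X.germToFunctionField V f, h⟩ = σ.app V f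

/-- An `F`-splitting of the pair `(X, Δ)` is a `⌈(p - 1) Δ⌉`-splitting of `X`. -/
def FSplitting.IsPairSplitting (σ : FSplitting p X) (Δ : AlgebraicCycle X ℚ) : Prop :=
  σ.IsDivisorSplitting (ceilMul ((p : ℚ) - 1) Δ)

variable (p) in
/-- The pair `(X, Δ)` is `F`-split. -/
def IsFSplit (Δ : AlgebraicCycle X ℚ) : Prop :=
  ∃ σ : FSplitting p X, σ.IsPairSplitting Δ

variable (p) in
/-- The pair `(X, Δ)` is `F`-split compatibly with the closed subscheme defined by `I`. -/
def IsFSplitCompatibly (Δ : AlgebraicCycle X ℚ) (I : X.IdealSheafData) : Prop :=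
  ∃ σ : FSplitting p X, σ.IsPairSplitting Δ ∧ σ.IsCompatible I

variable (p) in
/-- The natural map `𝒪_X → F^e_* (𝒪_X(D))`, `f ↦ f ^ (p ^ e)`, splits as a morphism of
`𝒪_X`-modules. -/
def SplitsAlong (e : ℕ) (D : AlgebraicCycle X ℤ) : Prop :=
  ∃ φ : FrobeniusHom p e D, ∀ (V : X.Opens) [Nonempty V] (f : Γ(X, V)),
    ∃ h : X.germToFunctionField V (f ^ p ^ e) ∈ divisorSections D V,
      φ.app V ⟨X.germToFunctionField V (f ^ p ^ e), h⟩ = f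

variable (p) in
/-- The pair `(X, Δ)` is (globally) `F`-regular: for every effective divisor `D > 0` there is an
`e > 0` such that `𝒪_X → F^e_* (𝒪_X(⌈(p ^ e - 1) Δ⌉ + D))` splits. -/
def IsFRegular (Δ : AlgebraicCycle X ℚ) : Prop :=
  ∀ D : AlgebraicCycle X ℤ, IsDivisor D → (∀ x, 0 ≤ D x) → D ≠ 0 →
    ∃ e : ℕ, 0 < e ∧ SplitsAlong p e (ceilMul ((p : ℚ) ^ e - 1) Δ + D)

end Frobenius

/-! ### Separations -/

section Separation

variable {Y Z : Scheme.{u}}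

/-- A separation of the `k`-scheme `Y`: a rational map of `k`-schemes `s : Y ⇢ Z` to a separated
`k`-scheme `Z`, defined on a big open subset of `Y` which `s` maps locally isomorphically onto a
big open subset of `Z`.  The open subset `s.domain` is the one occurring in this definition. -/
structure IsSeparation (k : Type u) [Field k] [Y.Over (Spec (.of k))] [Z.Over (Spec (.of k))]
    (s : Y.PartialMap Z) : Prop where
  isOver : s.IsOver (Spec (.of k))
  isSeparated : IsSeparated (Z ↘ Spec (.of k))
  isBig_domain : IsBig (s.domain : Set Y)
  isLocalIso : IsLocalIso s.hom
  isBig_range : IsBig (Set.range s.hom)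

/-- The coefficients `a_P` of `Δ` at the prime divisors `P ⊆ s⁻¹(P')`, where `P'` is the prime
divisor with generic point `z`. -/
def coeffsOver (s : Y.PartialMap Z) (Δ : AlgebraicCycle Y ℚ) (z : Z) : Set ℚ :=
  {a | ∃ y : s.domain, coheight (y : Y) = 1 ∧ s.hom y = z ∧ Δ (y : Y) = a}

theorem coeffsOver_finite [CompactSpace Y] (s : Y.PartialMap Z) (Δ : AlgebraicCycle Y ℚ) (z : Z) :
    (coeffsOver s Δ z).Finite := by
  have hfin : (Function.support Δ).Finite := by
    have := LocallyFiniteSupport.finite_inter_support_of_isCompact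
      (Function.locallyFinsupp.locallyFiniteSupport Δ) (isCompact_univ (X := Y))
    rwa [Set.univ_inter] at this
  refine ((hfin.image Δ).union (Set.finite_singleton 0)).subset ?_
  rintro a ⟨y, -, -, rfl⟩
  by_cases h : Δ (y : Y) = 0
  · exact Or.inr h
  · exact Or.inl ⟨_, h, rfl⟩

open Classical in
/-- The divisor `s_max Δ = ∑_{P'} max {a_P | P ⊆ s⁻¹(P')} P'` on `Z`, for a `ℚ`-divisor
`Δ = ∑_P a_P P` on `Y`. -/
def sMax [CompactSpace Y] (s : Y.PartialMap Z) (Δ : AlgebraicCycle Y ℚ) : AlgebraicCycle Z ℚ where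
  toFun z :=
    if h : coheight z = 1 ∧ (coeffsOver s Δ z).Nonempty then
      (coeffsOver_finite s Δ z).toFinset.max' ((Set.Finite.toFinset_nonempty _).mpr h.2)
    else 0
  supportWithinDomain' := Set.subset_univ _
  supportLocallyFiniteWithinDomain' _ _ := by
    have hfin : (Function.support Δ).Finite := by
      have := LocallyFiniteSupport.finite_inter_support_of_isCompact
        (Function.locallyFinsupp.locallyFiniteSupport Δ) (isCompact_univ (X := Y))
      rwa [Set.univ_inter] at this
    refine ⟨Set.univ, Filter.univ_mem, ?_⟩
    refine ((hfin.preimage (f := fun y : s.domain => (y : Y))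
      Subtype.val_injective.injOn).image s.hom).subset ?_
    rintro z ⟨-, hz⟩
    rw [Function.mem_support] at hz
    split_ifs at hz with h
    · obtain ⟨y, -, hy, hya⟩ := (coeffsOver_finite s Δ z).mem_toFinset.mp
        (Finset.max'_mem _ ((Set.Finite.toFinset_nonempty _).mpr h.2))
      refine ⟨y, ?_, hy⟩
      rw [← hya] at hz
      exact hz
    · exact absurd rfl hz

/-- The part `S ∩ U` of the closed subscheme `S ⊆ Y` with ideal sheaf `I` in the open subset
`U = s.domain` on which `s` is defined, as a closed subscheme of `U`. -/
def domainPart (s : Y.PartialMap Z) (I : Y.IdealSheafData) :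
    (s.domain : Scheme.{u}).IdealSheafData :=
  I.comap s.domain.ι

/-- The closure in `Y` of `S ∩ U` (the smallest closed subscheme of `Y` through which `S ∩ U → Y`
factors), where `S` is the closed subscheme with ideal sheaf `I` and `U = s.domain`. -/
def domainClosure (s : Y.PartialMap Z) (I : Y.IdealSheafData) : Y.IdealSheafData :=
  (domainPart s I).map s.domain.ι

/-- The closed subscheme `closure (s(S))` of `Z` (the smallest closed subscheme of `Z` through which
`S ∩ U → Z` factors), where `S` is the closed subscheme with ideal sheaf `I` and `U = s.domain`. -/
def imageClosure (s : Y.PartialMap Z) (I : Y.IdealSheafData) : Z.IdealSheafData :=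
  (domainPart s I).map s.hom

/-- The map `S ∩ U → Z` induced by `s`. -/
def imageMap (s : Y.PartialMap Z) (I : Y.IdealSheafData) : (domainPart s I).subscheme ⟶ Z :=
  (domainPart s I).subschemeι ≫ s.hom

/-- No irreducible component of `S ∩ U` has an image in `Z` whose closure is properly contained in
the closure of the image of another irreducible component. -/
def HasUnnestedImages (s : Y.PartialMap Z) (I : Y.IdealSheafData) : Prop :=
  ∀ C ∈ irreducibleComponents (domainPart s I).subscheme,
    ∀ C' ∈ irreducibleComponents (domainPart s I).subscheme,
      ¬ closure (imageMap s I '' C) ⊂ closure (imageMap s I '' C')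

end Separation

end

end FSep

namespace FSep

/-! On a normal Noetherian integral scheme, everything about splittings can be read off inside the
function field `K`. Sections are the rational functions regular at all codimension-one points, so a
map `F^e_* 𝒪(D) → 𝒪` with `D ≥ 0` amounts to a `p ^ (-e)`-linear map `φ : K → K` with a condition at
each codimension-one point (`IsFrobeniusForm`), and it splits exactly when `φ 1 = 1`. A separation
identifies the function fields of `Y` and `Ysep`, as well as the local ring and order at a point
with those at its image, and bigness means that no codimension-one point is missed. The condition at
a point of `Ysep` must hold for all its preimages, and it is implied by any one of them; hence the
maximum of the coefficients is the right one, and (B) follows.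

For (C), compatibility passes forward because ideals of scheme-theoretic images are defined by
pulling back. Conversely, a compatible subscheme is reduced, so membership in its ideal is tested at
generic points of components. Unnested images allow multiplying by a local function which is a unit
at one image point and vanishes on the images of the other components; its `p`-th power comes out of
`φ` (`FormCompatible.of_map`).

For (A), `Ysep` is an open subscheme `Z` of `Y`. The failure of separatedness is the closed set
`closure Δ \ Δ` in `Y × Y`, which has finitely many components. At the generic point of each, either
one projection has codimension `> 1`, or the two projections are distinct points with the same
valuation ring in `K`. Deleting one suitable projection for each component leaves `Z` separated,
with one representative of every codimension-one local ring (`exists_isSeparated_open`). The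
identity of `Z` then extends to a partial map `Y ⇢ Z` by spreading out isomorphisms of local rings.
-/

/-! ### Commutative algebra: orders of vanishing and height-one primes -/

theorem ord_ringEquiv {R S : Type*} [CommRing R] [CommRing S] (e : R ≃+* S) (x : R) :
    Ring.ord S (e x) = Ring.ord R x := by
  let := e.toRingHom.toAlgebra
  have h1 : (Ideal.span {x}).map e.toRingHom = Ideal.span {e x} := by
    rw [Ideal.map_span]; simp
  let q : (R ⧸ Ideal.span {x}) ≃ₗ[R] (S ⧸ Ideal.span {e x}) :=
    { (Ideal.quotientEquiv (Ideal.span {x}) (Ideal.span {e x}) e h1.symm) with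
      map_smul' := by
        intro r a
        exact map_mul (Ideal.quotientEquiv (Ideal.span {x}) (Ideal.span {e x}) e h1.symm)
          (Ideal.Quotient.mk _ r) a }
  rw [Ring.ord, Ring.ord, q.length_eq]
  exact (Module.length_eq_of_surjective (S := R) (R := S) e.surjective).symm



/-- If `h ∉ A`, the annihilator of its class in `K / A` lies in an associated prime `P = (A : g)`.
Were `g P ⊆ P`, then `g` would be integral over `A`, hence in `A`. So some `c ∈ P` has `v = c g ∈ A
\ P`, which makes `P` minimal over `(c)`, hence of height one by Krull. A denominator of `h` outside
`P` is then a contradiction. -/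
theorem mem_range_of_heightOne {A K : Type*} [CommRing A] [IsDomain A] [IsNoetherianRing A]
    [IsIntegrallyClosed A] [Field K] [Algebra A K] [IsFractionRing A K] (h : K)
    (H : ∀ P : Ideal A, P.IsPrime → P.height = 1 →
      ∃ a b : A, b ∉ P ∧ algebraMap A K b * h = algebraMap A K a) :
    h ∈ (algebraMap A K).range := by
  let N : Submodule A K := LinearMap.range (Algebra.linearMap A K)
  have hN : ∀ x : K, x ∈ N ↔ x ∈ (algebraMap A K).range := fun x => Iff.rfl
  by_contra hh
  have hx : N.mkQ h ≠ 0 := by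
    rw [Ne, Submodule.mkQ_apply, Submodule.Quotient.mk_eq_zero, hN]
    exact hh
  obtain ⟨P, hP, hle⟩ := exists_le_isAssociatedPrime_of_isNoetherianRing A (N.mkQ h) hx
  obtain ⟨hPp, x, hPx⟩ := isAssociatedPrime_iff.mp hP
  obtain ⟨g, rfl⟩ := N.mkQ_surjective x
  have hcol : ∀ (k : K) (c : A), c ∈ (⊥ : Submodule A (K ⧸ N)).colon {N.mkQ k} ↔
      ∃ a, algebraMap A K a = algebraMap A K c * k := by
    intro k c
    rw [Submodule.mem_colon_singleton, Submodule.mem_bot, ← map_smul, Submodule.mkQ_apply,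
      Submodule.Quotient.mk_eq_zero, hN, Algebra.smul_def]
    rfl
  have hPmem : ∀ c, c ∈ P ↔ ∃ a, algebraMap A K a = algebraMap A K c * g := by
    intro c; rw [hPx, hcol]
  have hinj := IsFractionRing.injective A K
  have hPbot : P ≠ ⊥ := by
    obtain ⟨a, b, hb, hab⟩ := IsFractionRing.div_surjective (A := A) g
    have hb0 : b ≠ 0 := nonZeroDivisors.ne_zero hb
    have : b ∈ P := by
      rw [hPmem]
      refine ⟨a, ?_⟩
      rw [← hab, mul_div_cancel₀]
      simpa using hb0
    rintro rfl
    exact hb0 this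
  have hht : P.height = 1 := by
    have hge : P.height ≠ 0 := by rwa [Ne, Ideal.height_eq_zero_iff_eq_bot]
    refine le_antisymm ?_ (Order.one_le_iff_ne_zero.mpr hge)
    by_cases hstab : ∀ c ∈ P, ∃ d ∈ P, algebraMap A K d = algebraMap A K c * g
    · exfalso
      let M : Submodule A K := Submodule.map (Algebra.linearMap A K) P
      have hint : _root_.IsIntegral A g := by
        refine isIntegral_of_smul_mem_submodule M ?_
          ((IsNoetherian.noetherian P).map _) g ?_
        · intro hM
          refine hPbot (Submodule.map_injective_of_injective
            (f := Algebra.linearMap A K) hinj ?_)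
          rw [Submodule.map_bot]; exact hM
        · rintro _ ⟨c, hc, rfl⟩
          obtain ⟨d, hd, hdc⟩ := hstab c hc
          refine ⟨d, hd, ?_⟩
          simpa [mul_comm] using hdc
      obtain ⟨a, ha⟩ := IsIntegrallyClosed.isIntegral_iff.mp hint
      exact hPp.ne_top ((Ideal.eq_top_iff_one _).mpr ((hPmem 1).mpr ⟨a, by simpa using ha⟩))
    · push Not at hstab
      obtain ⟨c, hc, hcd⟩ := hstab
      obtain ⟨v, hv⟩ := (hPmem c).mp hc
      have hvP : v ∉ P := fun hvP => hcd v hvP hv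
      refine Ideal.height_le_one_of_isPrincipal_of_mem_minimalPrimes (Ideal.span {c}) P
        ⟨⟨hPp, by simpa [Ideal.span_le] using hc⟩, ?_⟩
      -- For `d ∈ P`, the relation `d v = (d g) c` with `v ∉ P ⊇ Q` puts `d` in every prime `Q` with
      -- `c ∈ Q ⊆ P`.
      rintro Q ⟨hQ, hcQ⟩ hQP d hd
      obtain ⟨w, hw⟩ := (hPmem d).mp hd
      have hdv : d * v = w * c := by
        apply hinj
        rw [map_mul, map_mul, hv, hw]; ring
      have : d * v ∈ Q := by
        rw [hdv]; exact Q.mul_mem_left _ (hcQ (Ideal.mem_span_singleton_self c))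
      exact (hQ.mem_or_mem this).resolve_right fun h => hvP (hQP h)
  obtain ⟨a, b, hb, hab⟩ := H P hPp hht
  exact hb (hle ((hcol h b).mpr ⟨a, hab.symm⟩))

/-! ### Sections as rational functions regular in codimension one -/

section Scheme

variable {X : Scheme.{u}} [IsIntegral X]

/-- The local ring at a point of an integral scheme, as a subring of the function field. -/
noncomputable def stalkRange (x : X) : Subring X.functionField :=
  (algebraMap (X.presheaf.stalk x) X.functionField).range

theorem germ_mem_stalkRange {V : X.Opens} [Nonempty V] {x : X} (hx : x ∈ V) (f : Γ(X, V)) :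
    X.germToFunctionField V f ∈ stalkRange x :=
  ⟨X.presheaf.germ V x hx f, Scheme.algebraMap_germ_eq_germToFunctionField X hx f⟩

theorem exists_germ_of_mem_stalkRange {x : X} {h : X.functionField} (hh : h ∈ stalkRange x)
    (V : X.Opens) (hxV : x ∈ V) :
    ∃ (W : X.Opens) (hxW : x ∈ W) (_ : W ≤ V) (f : Γ(X, W)),
      haveI : Nonempty W := ⟨⟨x, hxW⟩⟩
      IsAffineOpen W ∧ X.germToFunctionField W f = h := by
  obtain ⟨g, rfl⟩ := hh
  obtain ⟨W, hxW, f, rfl⟩ := X.presheaf.exists_germ_eq g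
  obtain ⟨_, ⟨A, hA, rfl⟩, hxA, hAU⟩ :=
    X.isBasis_affineOpens.exists_subset_of_mem_open (show x ∈ W ⊓ V from ⟨hxW, hxV⟩) (W ⊓ V).isOpen
  have hAW : A ≤ W := fun y hy => (hAU hy).1
  refine ⟨A, hxA, fun y hy => (hAU hy).2, X.presheaf.map (homOfLE hAW).op f, hA, ?_⟩
  have : Nonempty W := ⟨⟨x, hxW⟩⟩
  rw [Scheme.algebraMap_germ_eq_germToFunctionField X hxW f]
  exact X.presheaf.germ_res_apply (homOfLE hAW) _ _ f

/-- A rational function which is regular at all points of `V` is a section over `V`. -/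
theorem exists_section_of_forall_mem_stalkRange (V : X.Opens) [Nonempty V] (h : X.functionField)
    (H : ∀ x ∈ V, h ∈ stalkRange x) : ∃ f : Γ(X, V), X.germToFunctionField V f = h := by
  choose W hxW hWV f hW using fun x : V => exists_germ_of_mem_stalkRange (H x x.2) V x.2
  have hη : ∀ (U : X.Opens), Nonempty U → genericPoint X ∈ U := fun U hU =>
    ((genericPoint_spec X).mem_open_set_iff U.isOpen).mpr (by simpa using hU)
  have hηW : ∀ x, genericPoint X ∈ W x := fun x => hη _ ⟨⟨x, hxW x⟩⟩
  obtain ⟨s, hs, -⟩ := TopCat.Sheaf.existsUnique_gluing' X.sheaf W V (fun x => homOfLE (hWV x))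
    (fun x hx => TopologicalSpace.Opens.mem_iSup.mpr ⟨⟨x, hx⟩, hxW _⟩) f (by
      intro i j
      apply germ_injective_of_isIntegral (X := X) (genericPoint X)
        (show genericPoint X ∈ W i ⊓ W j from ⟨hηW i, hηW j⟩)
      refine (X.presheaf.germ_res_apply _ _ _ _).trans
        (Eq.trans ?_ (X.presheaf.germ_res_apply _ _ _ _).symm)
      exact (hW i).2.trans (hW j).2.symm)
  refine ⟨s, ?_⟩
  obtain ⟨x⟩ := ‹Nonempty V›
  rw [← (hW x).2, ← hs x]
  exact (X.presheaf.germ_res_apply (homOfLE (hWV x)) _ (hηW x) s).symm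

theorem exists_isLocalization_stalk {X : Scheme.{u}} {V : X.Opens} (hV : IsAffineOpen V) (P : Ideal Γ(X, V))
    [P.IsPrime] : ∃ y : V, IsLocalization.AtPrime (X.presheaf.stalk (y : X)) P :=
  ⟨⟨_, (hV.isoSpec.inv _).2⟩, hV.isLocalization_stalk' ⟨P, ‹_›⟩ (hV.isoSpec.inv _).2⟩

theorem isIntegrallyClosed_section [IsNormal X] {V : X.Opens} [Nonempty V] (hV : IsAffineOpen V) :
    IsIntegrallyClosed Γ(X, V) := by
  refine IsIntegrallyClosed.of_localization_maximal fun p hp hpm => ?_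
  obtain ⟨y, hy⟩ := exists_isLocalization_stalk hV p
  have hn := IsNormal.isIntegrallyClosed_stalk (y : X)
  exact IsIntegrallyClosed.of_equiv (IsLocalization.algEquiv p.primeCompl
    (X.presheaf.stalk (y : X)) (Localization.AtPrime p)).toRingEquiv

/-- On a normal scheme, a rational function which is regular in codimension one is regular. -/
theorem exists_section_of_coheight_one [IsLocallyNoetherian X] [IsNormal X] (V : X.Opens)
    [Nonempty V] (h : X.functionField) (H : ∀ x ∈ V, coheight x = 1 → h ∈ stalkRange x) :
    ∃ f : Γ(X, V), X.germToFunctionField V f = h := by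
  refine exists_section_of_forall_mem_stalkRange V h fun x hx => ?_
  obtain ⟨_, ⟨W, hW, rfl⟩, hxW, hWV⟩ :=
    X.isBasis_affineOpens.exists_subset_of_mem_open hx V.isOpen
  have : Nonempty W := ⟨⟨x, hxW⟩⟩
  have := functionField_isFractionRing_of_isAffineOpen X W hW
  have := isIntegrallyClosed_section hW
  have : IsNoetherianRing Γ(X, W) := IsLocallyNoetherian.component_noetherian ⟨W, hW⟩
  obtain ⟨f, hf⟩ := mem_range_of_heightOne (A := Γ(X, W)) h fun P hP hht => by
    obtain ⟨y, hloc⟩ := exists_isLocalization_stalk hW P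
    have hco : coheight (y : X) = 1 := by
      have h1 := ringKrullDim_stalk_eq_coheight (y : X)
      rw [IsLocalization.AtPrime.ringKrullDim_eq_height P, hht] at h1
      exact_mod_cast h1.symm
    obtain ⟨g, rfl⟩ := H _ (hWV y.2) hco
    obtain ⟨⟨a, b⟩, hab⟩ := IsLocalization.surj P.primeCompl g
    refine ⟨a, b, b.2, ?_⟩
    have hst := functionField_isScalarTower X W y
    rw [IsScalarTower.algebraMap_apply Γ(X, W) (X.presheaf.stalk (y : X)),
      IsScalarTower.algebraMap_apply Γ(X, W) (X.presheaf.stalk (y : X)) X.functionField a,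
      ← map_mul, mul_comm, hab]
  rw [← hf]
  exact germ_mem_stalkRange hxW f

end Scheme

/-! ### Points of codimension one -/

section CodimOne

variable {X : Scheme.{u}} [IsIntegral X]

theorem eq_of_specializes_of_coheight_eq_one {t x : X} (h : t ⤳ x) (hx : coheight x = 1)
    (ht : t ≠ genericPoint X) : t = x := by
  by_contra hne
  have hlt : x < t := lt_of_le_not_ge h fun h' => hne (Specializes.antisymm h h').eq
  have h1 : coheight t + 1 ≤ coheight x := coheight_add_one_le hlt
  rw [hx] at h1
  have h0 : coheight t = 0 := by
    have : coheight t + 1 ≤ 0 + 1 := by simpa using h1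
    exact le_antisymm ((ENat.add_le_add_iff_right (by simp)).mp this) zero_le
  have hmax : IsMax t := coheight_eq_zero.mp h0
  exact ht (Specializes.antisymm (hmax (genericPoint_specializes t))
    (genericPoint_specializes t)).eq

theorem coheight_genericPoint : coheight (genericPoint X) = 0 :=
  coheight_eq_zero.mpr fun _ _ => genericPoint_specializes _

theorem eq_genericPoint_of_coheight_eq_zero {x : X} (hx : coheight x = 0) : x = genericPoint X :=
  (Specializes.antisymm (coheight_eq_zero.mp hx (genericPoint_specializes x))
    (genericPoint_specializes x)).eq

/-- Delete from `X` the components of `C` that avoid `x`. A component through `x` has generic point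
`x`, because the only proper generisation of `x` is the generic point of `X`; the same applies to
any other codimension-one point on that component. -/
theorem exists_open_inter_subset_singleton [IsNoetherian X] {C : Set X} (hC : IsClosed C)
    (hη : genericPoint X ∉ C) {x : X} (hx : coheight x = 1) :
    ∃ V : X.Opens, x ∈ V ∧ ∀ x' ∈ V, x' ∈ C → coheight x' = 1 → x' = x := by
  obtain ⟨S, hS, hirr, hCS⟩ :=
    TopologicalSpace.NoetherianSpace.exists_finite_set_isClosed_irreducible hC
  have hirr' := hCS.1
  let V : X.Opens := ⟨(⋃₀ {T ∈ S | x ∉ T})ᶜ, by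
    rw [isOpen_compl_iff, Set.sUnion_eq_biUnion]
    exact (hS.subset (Set.sep_subset _ _)).isClosed_biUnion fun T hT => hirr T hT.1⟩
  refine ⟨V, fun ⟨T, hT, hxT⟩ => hT.2 hxT, fun x' hx' hx'C hco => ?_⟩
  rw [hCS.2] at hx'C hη
  obtain ⟨T, hTS, hx'T⟩ := hx'C
  have hxT : x ∈ T := by
    by_contra hxT
    exact hx' ⟨T, ⟨hTS, hxT⟩, hx'T⟩
  obtain ⟨t, ht⟩ := QuasiSober.sober (hirr' T hTS) (hirr T hTS)
  have htη : t ≠ genericPoint X := by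
    rintro rfl
    exact hη ⟨T, hTS, ht.mem⟩
  rw [← eq_of_specializes_of_coheight_eq_one (ht.specializes hx'T) hco htη,
    eq_of_specializes_of_coheight_eq_one (ht.specializes hxT) hx htη]

instance nonempty_top : Nonempty (⊤ : X.Opens) := ⟨⟨genericPoint X, trivial⟩⟩

theorem mem_of_nonempty (V : X.Opens) [Nonempty V] : genericPoint X ∈ V :=
  ((genericPoint_spec X).mem_open_set_iff V.isOpen).mpr (by simpa using ‹Nonempty V›)

instance nonempty_inf (V W : X.Opens) [Nonempty V] [Nonempty W] : Nonempty (V ⊓ W : X.Opens) :=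
  ⟨⟨genericPoint X, mem_of_nonempty V, mem_of_nonempty W⟩⟩

theorem germ_map_homOfLE {V W : X.Opens} [Nonempty V] [Nonempty W] (h : V ≤ W) (f : Γ(X, W)) :
    X.germToFunctionField V (X.presheaf.map (homOfLE h).op f) = X.germToFunctionField W f :=
  X.presheaf.germ_res_apply (homOfLE h) _ _ f

theorem zero_le_ord_germ [IsLocallyNoetherian X] {V : X.Opens} [Nonempty V] {x : X} (hx : x ∈ V) (f : Γ(X, V)) :
    0 ≤ Scheme.ord (X.germToFunctionField V f) x := by
  by_cases hf : f = 0
  · simp [hf]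
  · have h1 := Scheme.ord_le_smul hx hf (1 : X.functionField)
    have h0 : Scheme.ord (1 : X.functionField) x = 0 := by
      rw [← map_one (X.germToFunctionField V).hom]
      exact Scheme.ord_of_isUnit isUnit_one hx
    rw [h0, Algebra.smul_def, mul_one] at h1
    exact h1

/-- The poles of `g` lie in a proper closed subset. This turns a bound on the pole at the single
point `x` into membership in `𝒪(D)` on a neighbourhood of `x`, for `D ≥ 0`. -/
theorem exists_open_zero_le_ord [IsNoetherian X] (g : X.functionField) {x : X}
    (hx : coheight x = 1) :
    ∃ V : X.Opens, x ∈ V ∧ ∀ x' ∈ V, coheight x' = 1 → x' ≠ x → 0 ≤ Scheme.ord g x' := by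
  by_cases hg : g = 0
  · exact ⟨⊤, trivial, fun x' _ _ _ => by simp [hg]⟩
  obtain ⟨W, -, f, hW, rfl, -⟩ := exists_isUnit_germ_eq X g hg
  obtain ⟨V, hxV, hV⟩ := exists_open_inter_subset_singleton (C := (W : Set X)ᶜ)
    (isClosed_compl_iff.mpr W.isOpen)
    (not_not_intro (mem_of_nonempty W)) hx
  refine ⟨V, hxV, fun x' hx'V hco hne => ?_⟩
  have : x' ∈ W := by
    by_contra hx'W
    exact hne (hV x' hx'V hx'W hco)
  exact zero_le_ord_germ this f

end CodimOne

/-! ### Frobenius splittings as maps of the function field -/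

section FrobeniusForm

variable {X : Scheme.{u}} [IsIntegral X] [IsNoetherian X]

/-- A `p ^ (-e)`-linear endomorphism of the function field which, at all points of codimension one,
maps the rational functions with poles bounded by `D` to regular functions. -/
structure IsFrobeniusForm (p e : ℕ) (D : X → ℤ) (φ : X.functionField →+ X.functionField) :
    Prop where
  map_pow_mul : ∀ f g, φ (f ^ p ^ e * g) = f * φ g
  mem_stalkRange : ∀ x, coheight x = 1 → ∀ g, (g = 0 ∨ - D x ≤ Scheme.ord g x) →
    φ g ∈ stalkRange x

theorem IsFrobeniusForm.apply_pow {p e : ℕ} {D : X → ℤ} {φ : X.functionField →+ X.functionField}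
    (h : IsFrobeniusForm p e D φ) (h1 : φ 1 = 1) (f : X.functionField) : φ (f ^ p ^ e) = f := by
  have := h.map_pow_mul f 1
  rwa [mul_one, h1, mul_one] at this

variable [IsNormal X] {p e : ℕ} {D : AlgebraicCycle X ℤ}

theorem germ_mem_divisorSections (hD : ∀ x, 0 ≤ D x) (V : X.Opens) [Nonempty V] (f : Γ(X, V)) :
    X.germToFunctionField V f ∈ divisorSections D V :=
  Or.inr fun x hx _ => (by linarith [hD x] : - D x ≤ 0).trans (zero_le_ord_germ hx f)

theorem IsFrobeniusForm.exists_section {φ : X.functionField →+ X.functionField}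
    (h : IsFrobeniusForm p e D φ) (V : X.Opens) [Nonempty V] {g : X.functionField}
    (hg : g ∈ divisorSections D V) : ∃ f : Γ(X, V), X.germToFunctionField V f = φ g :=
  exists_section_of_coheight_one V _ fun x hx hco =>
    h.mem_stalkRange x hco g (hg.imp_right fun hg => hg x hx hco)

/-- An additive map which takes values in the range of an injective map, lifted to its source. -/
noncomputable def liftOfInjective {A B M : Type*} [AddGroup A] [AddGroup B] [AddGroup M]
    (ι : A →+ B) (hι : Function.Injective ι) (ψ : M →+ B) (H : ∀ m, ∃ a, ι a = ψ m) : M →+ A :=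
  (AddMonoidHom.ofInjective hι).symm.toAddMonoidHom.comp (ψ.codRestrict ι.range H)

theorem liftOfInjective_spec {A B M : Type*} [AddGroup A] [AddGroup B] [AddGroup M]
    (ι : A →+ B) (hι : Function.Injective ι) (ψ : M →+ B) (H : ∀ m, ∃ a, ι a = ψ m) (m : M) :
    ι (liftOfInjective ι hι ψ H m) = ψ m :=
  AddMonoidHom.apply_ofInjective_symm hι (ψ.codRestrict ι.range H m)

/-- The map on sections given by a `p ^ (-e)`-linear endomorphism of the function field. -/
noncomputable def IsFrobeniusForm.appHom {φ : X.functionField →+ X.functionField}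
    (h : IsFrobeniusForm p e D φ) (V : X.Opens) [Nonempty V] : divisorSections D V →+ Γ(X, V) :=
  liftOfInjective (X.germToFunctionField V).hom.toAddMonoidHom (X.germToFunctionField_injective V)
    (φ.comp (divisorSections D V).subtype.toAddMonoidHom) fun g => h.exists_section V g.2

theorem IsFrobeniusForm.germ_appHom {φ : X.functionField →+ X.functionField}
    (h : IsFrobeniusForm p e D φ) (V : X.Opens) [Nonempty V] (g : divisorSections D V) :
    X.germToFunctionField V (h.appHom V g) = φ g :=
  liftOfInjective_spec (X.germToFunctionField V).hom.toAddMonoidHom _ _ _ g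

/-- The morphism of sheaves given by a `p ^ (-e)`-linear endomorphism of the function field. -/
noncomputable def IsFrobeniusForm.toFrobeniusHom {φ : X.functionField →+ X.functionField}
    (h : IsFrobeniusForm p e D φ) : FrobeniusHom p e D where
  app V _ := h.appHom V
  app_smul V _ f g := X.germToFunctionField_injective V <| by
    rw [map_mul, h.germ_appHom, h.germ_appHom, ← h.map_pow_mul, ← map_pow]
    rfl
  app_res {V W} _ _ hVW g := X.germToFunctionField_injective V <| by
    rw [germ_map_homOfLE, h.germ_appHom, h.germ_appHom]

theorem IsFrobeniusForm.germ_toFrobeniusHom {φ : X.functionField →+ X.functionField}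
    (h : IsFrobeniusForm p e D φ) (V : X.Opens) [Nonempty V] (g : divisorSections D V) :
    X.germToFunctionField V (h.toFrobeniusHom.app V g) = φ g :=
  h.germ_appHom V g

theorem exists_mem_divisorSections (hD : ∀ x, 0 ≤ D x) (g : X.functionField) :
    ∃ (V : X.Opens) (_ : Nonempty V), g ∈ divisorSections D V := by
  by_cases hg : g = 0
  · exact ⟨⊤, inferInstance, Or.inl hg⟩
  obtain ⟨W, -, f, hW, rfl, -⟩ := exists_isUnit_germ_eq X g hg
  exact ⟨W, hW, germ_mem_divisorSections hD W f⟩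

theorem FrobeniusHom.germ_app_eq (Φ : FrobeniusHom p e D) {V W : X.Opens} [Nonempty V] [Nonempty W]
    {g : X.functionField} (hV : g ∈ divisorSections D V) (hW : g ∈ divisorSections D W) :
    X.germToFunctionField V (Φ.app V ⟨g, hV⟩) = X.germToFunctionField W (Φ.app W ⟨g, hW⟩) := by
  rw [← germ_map_homOfLE (inf_le_left : V ⊓ W ≤ V), ← germ_map_homOfLE (inf_le_right : V ⊓ W ≤ W),
    Φ.app_res, Φ.app_res]

/-- As `D ≥ 0`, every rational function is a section of `𝒪(D)` over some nonempty open subset, and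
compatibility with restriction makes its image independent of the choice. For regularity at `x`,
evaluate on a neighbourhood where `x` is the only possible pole. -/
theorem FrobeniusHom.exists_isFrobeniusForm [hp : Fact p.Prime] (Φ : FrobeniusHom p e D) (hD : ∀ x, 0 ≤ D x) :
    ∃ φ : X.functionField →+ X.functionField, IsFrobeniusForm p e D φ ∧
      ∀ (V : X.Opens) [Nonempty V] (g : divisorSections D V),
        X.germToFunctionField V (Φ.app V g) = φ g := by
  choose V hV hg using exists_mem_divisorSections (X := X) hD
  let F : X.functionField → X.functionField := fun g =>
    X.germToFunctionField (V g) (Φ.app (V g) ⟨g, hg g⟩)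
  have key : ∀ (W : X.Opens) [Nonempty W] (g : divisorSections D W),
      X.germToFunctionField W (Φ.app W g) = F g := fun W _ g => Φ.germ_app_eq g.2 (hg g)
  let φ : X.functionField →+ X.functionField :=
    { toFun := F
      map_zero' := by
        have h0 := key ⊤ 0
        rw [map_zero, map_zero] at h0
        exact h0.symm
      map_add' := fun a b => by
        have ha := divisorSections_mono D (inf_le_left : V a ⊓ V b ≤ V a) (hg a)
        have hb := divisorSections_mono D (inf_le_right : V a ⊓ V b ≤ V b) (hg b)
        have hab := key (V a ⊓ V b) (⟨a, ha⟩ + ⟨b, hb⟩)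
        rw [map_add, map_add, key, key] at hab
        exact hab.symm }
  have hφ : ∀ g, φ g = F g := fun g => rfl
  have hsmul : ∀ f g, φ (f ^ p ^ e * g) = f * φ g := by
    intro f g
    by_cases hf : f = 0
    · subst hf
      rw [zero_pow (pow_ne_zero e hp.out.ne_zero), zero_mul, zero_mul, map_zero]
    obtain ⟨W, -, a, hW, rfl, -⟩ := exists_isUnit_germ_eq X f hf
    have hg' := divisorSections_mono D (inf_le_right : W ⊓ V g ≤ V g) (hg g)
    let a' : Γ(X, W ⊓ V g) := X.presheaf.map (homOfLE inf_le_left).op a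
    have := key (W ⊓ V g) (a' ^ p ^ e • ⟨g, hg'⟩)
    rw [Φ.app_smul, map_mul, germ_map_homOfLE, key] at this
    rw [hφ, hφ, this, Submodule.coe_smul, Algebra.smul_def, map_pow]
    congr 3
    exact (germ_map_homOfLE inf_le_left a).symm
  refine ⟨φ, ⟨hsmul, fun x hx g hgx => ?_⟩, key⟩
  obtain ⟨W, hxW, hW⟩ := exists_open_zero_le_ord g hx
  have : Nonempty W := ⟨⟨x, hxW⟩⟩
  have hgW : g ∈ divisorSections D W := by
    refine hgx.imp_right fun hgx x' hx'W hco => ?_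
    by_cases hne : x' = x
    · rwa [hne]
    · exact (by linarith [hD x'] : - D x' ≤ 0).trans (hW x' hx'W hco hne)
  rw [hφ, ← key W ⟨g, hgW⟩]
  exact germ_mem_stalkRange hxW _

/-- By `p ^ (-e)`-linearity `φ (f ^ p ^ e) = f * φ 1`, so being a splitting is the single equation
`φ 1 = 1`. -/
theorem splitsAlong_iff [Fact p.Prime] (hD : ∀ x, 0 ≤ D x) : SplitsAlong p e D ↔
    ∃ φ : X.functionField →+ X.functionField, IsFrobeniusForm p e D φ ∧ φ 1 = 1 := by
  constructor
  · rintro ⟨Φ, hΦ⟩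
    obtain ⟨φ, hφ, hΦφ⟩ := Φ.exists_isFrobeniusForm hD
    refine ⟨φ, hφ, ?_⟩
    obtain ⟨h, h1⟩ := hΦ ⊤ 1
    have := hΦφ ⊤ ⟨_, h⟩
    rw [h1] at this
    simpa using this.symm
  · rintro ⟨φ, hφ, h1⟩
    refine ⟨hφ.toFrobeniusHom, fun V _ f => ⟨germ_mem_divisorSections hD V _, ?_⟩⟩
    apply X.germToFunctionField_injective V
    rw [hφ.germ_toFrobeniusHom]
    simpa using hφ.apply_pow h1 (X.germToFunctionField V f)

variable {φ : X.functionField →+ X.functionField}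

theorem FSplitting.IsDivisorSplitting.exists_isFrobeniusForm [Fact p.Prime] {σ : FSplitting p X}
    (hσ : σ.IsDivisorSplitting D) (hD : ∀ x, 0 ≤ D x) :
    ∃ φ : X.functionField →+ X.functionField, IsFrobeniusForm p 1 D φ ∧ φ 1 = 1 ∧
      ∀ (V : X.Opens) [Nonempty V] (f : Γ(X, V)),
        X.germToFunctionField V (σ.app V f) = φ (X.germToFunctionField V f) := by
  obtain ⟨Φ, hΦ⟩ := hσ
  obtain ⟨φ, hφ, hΦφ⟩ := Φ.exists_isFrobeniusForm hD
  have key : ∀ (V : X.Opens) [Nonempty V] (f : Γ(X, V)),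
      X.germToFunctionField V (σ.app V f) = φ (X.germToFunctionField V f) := by
    intro V _ f
    obtain ⟨h, h1⟩ := hΦ V f
    rw [← h1, hΦφ]
  refine ⟨φ, hφ, ?_, key⟩
  have := key ⊤ (1 ^ p)
  rw [σ.app_pow] at this
  simpa using this.symm

theorem IsFrobeniusForm.exists_fSplitting (h : IsFrobeniusForm p 1 D φ) (h1 : φ 1 = 1)
    (hD : ∀ x, 0 ≤ D x) : ∃ σ : FSplitting p X, σ.IsDivisorSplitting D ∧
      ∀ (V : X.Opens) [Nonempty V] (f : Γ(X, V)),
        X.germToFunctionField V (σ.app V f) = φ (X.germToFunctionField V f) := by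
  classical
  -- An `FSplitting` also carries a map over the empty open subset, which the function field does
  -- not see.
  have hsub : ∀ V : X.Opens, ¬ Nonempty V → Subsingleton Γ(X, V) := by
    intro V hV
    have : V = ⊥ := by
      ext x
      simpa using fun hx => hV ⟨⟨x, hx⟩⟩
    subst this
    infer_instance
  have hex : ∀ V : X.Opens, ∃ F : Γ(X, V) →+ Γ(X, V), ∀ [Nonempty V] (f : Γ(X, V)),
      X.germToFunctionField V (F f) = φ (X.germToFunctionField V f) := by
    intro V
    by_cases hV : Nonempty V
    · exact ⟨liftOfInjective (X.germToFunctionField V).hom.toAddMonoidHom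
        (X.germToFunctionField_injective V) (φ.comp (X.germToFunctionField V).hom.toAddMonoidHom)
        fun f => h.exists_section V (germ_mem_divisorSections hD V f), fun {_} f =>
        liftOfInjective_spec (X.germToFunctionField V).hom.toAddMonoidHom _ _ _ f⟩
    · exact ⟨0, fun {h} => absurd h hV⟩
  choose F hF using hex
  have hext : ∀ (V : X.Opens) (a b : Γ(X, V)), (∀ [Nonempty V], X.germToFunctionField V a =
      X.germToFunctionField V b) → a = b := by
    intro V a b hab
    by_cases hV : Nonempty V
    · exact X.germToFunctionField_injective V hab
    · have := hsub V hV
      exact Subsingleton.elim _ _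
  have hmul : ∀ f g, φ (f ^ p * g) = f * φ g := by simpa using h.map_pow_mul
  let σ : FSplitting p X :=
    { app := F
      app_smul := fun V f g => hext V _ _ fun {_} => by
        rw [hF, map_mul, map_pow, hmul, map_mul, hF]
      app_res := fun {V W} hVW g => hext V _ _ fun {hV} => by
        have : Nonempty W := ⟨⟨_, hVW hV.some.2⟩⟩
        rw [hF, germ_map_homOfLE, germ_map_homOfLE, hF]
      app_pow := fun V f => hext V _ _ fun {_} => by
        rw [hF, map_pow]
        simpa using h.apply_pow h1 (X.germToFunctionField V f) }
  refine ⟨σ, ⟨h.toFrobeniusHom, fun V _ f => ⟨germ_mem_divisorSections hD V f, ?_⟩⟩, fun V _ => hF V⟩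
  apply X.germToFunctionField_injective V
  rw [h.germ_toFrobeniusHom]
  exact (hF V f).symm

end FrobeniusForm

/-! ### Transport along local isomorphisms -/

theorem ordFrac_ringEquiv {R S K L : Type*} [CommRing R] [CommRing S] [IsDomain R] [IsDomain S]
    [IsNoetherianRing R] [IsNoetherianRing S] [Ring.KrullDimLE 1 R] [Ring.KrullDimLE 1 S]
    [Field K] [Field L] [Algebra R K] [Algebra S L] [IsFractionRing R K] [IsFractionRing S L]
    (e : R ≃+* S) (θ : K →+* L) (h : ∀ a, θ (algebraMap R K a) = algebraMap S L (e a)) (g : K) :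
    Ring.ordFrac S (θ g) = Ring.ordFrac R g := by
  have key : ∀ a : R, a ≠ 0 →
      Ring.ordFrac S (θ (algebraMap R K a)) = Ring.ordFrac R (algebraMap R K a) := by
    intro a ha
    have ha' : e a ≠ 0 := by simpa using ha
    rw [h, Ring.ordFrac_eq_ord R ha, Ring.ordFrac_eq_ord S ha',
      Ring.ordMonoidWithZeroHom_eq_ord (mem_nonZeroDivisors_of_ne_zero ha),
      Ring.ordMonoidWithZeroHom_eq_ord (mem_nonZeroDivisors_of_ne_zero ha'), ord_ringEquiv]
  obtain ⟨a, b, hb, rfl⟩ := IsFractionRing.div_surjective (A := R) g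
  by_cases ha : a = 0
  · simp [ha]
  · rw [map_div₀, map_div₀, map_div₀, key a ha, key b (nonZeroDivisors.ne_zero hb)]

section LocalIso

variable {U W : Scheme.{u}} (f : U ⟶ W) [IsLocalIso f]

theorem exists_isOpenImmersion_ι (x : U) :
    ∃ V : U.Opens, x ∈ V ∧ IsOpenImmersion (V.ι ≫ f) :=
  IsLocalIso.exists_isOpenImmersion x

instance isIso_stalkMap (x : U) : IsIso (f.stalkMap x) := by
  obtain ⟨V, hxV, hV⟩ := exists_isOpenImmersion_ι f x
  have key : ∀ y : (V : Scheme.{u}), IsIso (f.stalkMap (V.ι y)) := fun y => by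
    have h0 : IsIso ((V.ι ≫ f).stalkMap y) := inferInstance
    have h1 : IsIso (f.stalkMap (V.ι y) ≫ V.ι.stalkMap y) := by
      rw [← Scheme.Hom.stalkMap_comp V.ι f y]; exact h0
    exact IsIso.of_isIso_comp_right (f.stalkMap (V.ι y)) (V.ι.stalkMap y)
  exact key ⟨x, hxV⟩

/-- The isomorphism of local rings induced by a local isomorphism. -/
noncomputable def stalkEquiv (x : U) : W.presheaf.stalk (f x) ≃+* U.presheaf.stalk x :=
  (asIso (f.stalkMap x)).commRingCatIsoToRingEquiv

theorem coheight_of_isLocalIso (x : U) : coheight (f x) = coheight x := by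
  have h := ringKrullDim_eq_of_ringEquiv (stalkEquiv f x)
  rw [ringKrullDim_stalk_eq_coheight, ringKrullDim_stalk_eq_coheight] at h
  exact_mod_cast h

variable [IsIntegral U] [IsIntegral W]

theorem map_genericPoint : f (genericPoint U) = genericPoint W := by
  obtain ⟨V, hxV, hV⟩ := exists_isOpenImmersion_ι f (genericPoint U)
  have : Nonempty V := ⟨⟨_, hxV⟩⟩
  rw [← genericPoint_eq_of_isOpenImmersion V.ι, ← genericPoint_eq_of_isOpenImmersion (V.ι ≫ f)]
  simp

theorem map_genericPoint_specializes : f (genericPoint U) ⤳ genericPoint W :=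
  (Inseparable.of_eq (map_genericPoint f)).specializes

instance isIso_stalkSpecializes_map_genericPoint :
    IsIso (W.presheaf.stalkSpecializes (map_genericPoint_specializes f)) :=
  (W.presheaf.stalkCongr (Inseparable.of_eq (map_genericPoint f).symm)).isIso_hom

/-- The isomorphism of function fields induced by a local isomorphism of integral schemes. -/
noncomputable def functionFieldEquiv : W.functionField ≃+* U.functionField :=
  (asIso (W.presheaf.stalkSpecializes (map_genericPoint_specializes f) ≫
    f.stalkMap (genericPoint U))).commRingCatIsoToRingEquiv

theorem functionFieldEquiv_algebraMap (x : U) (a : W.presheaf.stalk (f x)) :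
    functionFieldEquiv f (algebraMap _ W.functionField a) =
      algebraMap _ U.functionField (stalkEquiv f x a) := by
  have h : W.presheaf.stalkSpecializes (genericPoint_specializes (f x)) ≫
      W.presheaf.stalkSpecializes (map_genericPoint_specializes f) ≫
      f.stalkMap (genericPoint U) =
      f.stalkMap x ≫ U.presheaf.stalkSpecializes (genericPoint_specializes x) := by
    rw [← Scheme.Hom.stalkSpecializes_stalkMap, TopCat.Presheaf.stalkSpecializes_comp_assoc]
  exact ConcreteCategory.congr_hom h a

theorem functionFieldEquiv_germ (V : W.Opens) [Nonempty V] [Nonempty (f ⁻¹ᵁ V)] (a : Γ(W, V)) :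
    functionFieldEquiv f (W.germToFunctionField V a) =
      U.germToFunctionField (f ⁻¹ᵁ V) (f.app V a) := by
  have h : W.germToFunctionField V ≫
      W.presheaf.stalkSpecializes (map_genericPoint_specializes f) ≫
      f.stalkMap (genericPoint U) = f.app V ≫ U.germToFunctionField (f ⁻¹ᵁ V) := by
    rw [TopCat.Presheaf.germ_stalkSpecializes_assoc, Scheme.Hom.germ_stalkMap]
  exact ConcreteCategory.congr_hom h a

theorem functionFieldEquiv_mem_stalkRange {x : U} {g : W.functionField} :
    functionFieldEquiv f g ∈ stalkRange x ↔ g ∈ stalkRange (f x) := by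
  constructor
  · rintro ⟨b, hb⟩
    refine ⟨(stalkEquiv f x).symm b, (functionFieldEquiv f).injective ?_⟩
    rw [functionFieldEquiv_algebraMap, RingEquiv.apply_symm_apply, hb]
  · rintro ⟨a, rfl⟩
    exact ⟨_, (functionFieldEquiv_algebraMap f x a).symm⟩

theorem ord_functionFieldEquiv [IsLocallyNoetherian U] [IsLocallyNoetherian W] {x : U}
    (hx : coheight x = 1) (g : W.functionField) :
    Scheme.ord (functionFieldEquiv f g) x = Scheme.ord g (f x) := by
  have hx' : coheight (f x) = 1 := by rw [coheight_of_isLocalIso, hx]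
  have h1 : Ring.KrullDimLE 1 (U.presheaf.stalk x) := krullDimLE_of_coheight_le hx.le
  have h2 : Ring.KrullDimLE 1 (W.presheaf.stalk (f x)) := krullDimLE_of_coheight_le hx'.le
  rw [Scheme.ord_eq_ordHom_of_coheight_eq_one hx, Scheme.ord_eq_ordHom_of_coheight_eq_one hx']
  congr 2
  exact ordFrac_ringEquiv (stalkEquiv f x) (functionFieldEquiv f).toRingHom
    (functionFieldEquiv_algebraMap f x) g

variable {p e : ℕ} {DU : U → ℤ} {DW : W → ℤ}

/-- Transport of endomorphisms of the function field along a local isomorphism. -/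
noncomputable def pullbackForm : (W.functionField →+ W.functionField) ≃
    (U.functionField →+ U.functionField) where
  toFun φ := ((functionFieldEquiv f).toAddMonoidHom.comp φ).comp
    (functionFieldEquiv f).symm.toAddMonoidHom
  invFun φ := ((functionFieldEquiv f).symm.toAddMonoidHom.comp φ).comp
    (functionFieldEquiv f).toAddMonoidHom
  left_inv φ := by ext; simp
  right_inv φ := by ext; simp

theorem pullbackForm_apply (φ : W.functionField →+ W.functionField) (g : W.functionField) :
    pullbackForm f φ (functionFieldEquiv f g) = functionFieldEquiv f (φ g) := by
  simp [pullbackForm]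

theorem pullbackForm_one {φ : W.functionField →+ W.functionField} :
    pullbackForm f φ 1 = 1 ↔ φ 1 = 1 := by
  have := pullbackForm_apply f φ 1
  rw [map_one] at this
  rw [this, map_eq_one_iff _ (functionFieldEquiv f).injective]

variable {f} [IsNoetherian U] [IsNoetherian W]

theorem IsFrobeniusForm.pullback {φ : W.functionField →+ W.functionField}
    (h : IsFrobeniusForm p e DW φ) (hD : ∀ x : U, coheight x = 1 → DU x ≤ DW (f x)) :
    IsFrobeniusForm p e DU (pullbackForm f φ) where
  map_pow_mul a b := by
    obtain ⟨a, rfl⟩ := (functionFieldEquiv f).surjective a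
    obtain ⟨b, rfl⟩ := (functionFieldEquiv f).surjective b
    rw [← map_pow, ← map_mul, pullbackForm_apply, h.map_pow_mul, map_mul, pullbackForm_apply]
  mem_stalkRange x hx g hg := by
    obtain ⟨g, rfl⟩ := (functionFieldEquiv f).surjective g
    rw [pullbackForm_apply, functionFieldEquiv_mem_stalkRange]
    refine h.mem_stalkRange (f x) (by rw [coheight_of_isLocalIso, hx]) g (hg.imp ?_ ?_)
    · exact fun hg => (map_eq_zero_iff _ (functionFieldEquiv f).injective).mp hg
    · intro hg
      rw [ord_functionFieldEquiv f hx] at hg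
      linarith [hD x hx]

/-- The local ring and the order at `z` agree with those at any preimage, so one preimage with a
large enough coefficient suffices. For `sMax` it is the one attaining the maximum. -/
theorem IsFrobeniusForm.of_pullback {φ : W.functionField →+ W.functionField}
    (h : IsFrobeniusForm p e DU (pullbackForm f φ))
    (hD : ∀ z : W, coheight z = 1 → ∃ x, f x = z ∧ DW z ≤ DU x) :
    IsFrobeniusForm p e DW φ where
  map_pow_mul a b := by
    apply (functionFieldEquiv f).injective
    rw [← pullbackForm_apply, map_mul, map_pow, h.map_pow_mul, pullbackForm_apply, map_mul]
  mem_stalkRange z hz g hg := by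
    obtain ⟨x, rfl, hx⟩ := hD z hz
    have hx1 : coheight x = 1 := by rw [← coheight_of_isLocalIso f, hz]
    rw [← functionFieldEquiv_mem_stalkRange f, ← pullbackForm_apply]
    refine h.mem_stalkRange x hx1 _ (hg.imp ?_ ?_)
    · rintro rfl; simp
    · intro hg
      rw [ord_functionFieldEquiv f hx1]
      linarith

end LocalIso

instance isLocalIso_of_isOpenImmersion {U W : Scheme.{u}} (f : U ⟶ W) [IsOpenImmersion f] :
    IsLocalIso f :=
  ⟨fun _ => ⟨⊤, trivial, inferInstance⟩⟩

theorem IsNormal.of_isLocalIso {U W : Scheme.{u}} (f : U ⟶ W) [IsLocalIso f] [IsNormal W] : IsNormal U where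
  isDomain_stalk x :=
    have := IsNormal.isDomain_stalk (f x)
    (stalkEquiv f x).symm.toMulEquiv.isDomain _
  isIntegrallyClosed_stalk x :=
    have := IsNormal.isIntegrallyClosed_stalk (f x)
    IsIntegrallyClosed.of_equiv (stalkEquiv f x)

section LocalIso

variable {U W : Scheme.{u}} (f : U ⟶ W) [IsLocalIso f]

theorem finite_preimage_of_isLocalIso [CompactSpace U] {A : Set W} (hA : A.Finite) :
    (f ⁻¹' A).Finite := by
  choose V hxV hV using exists_isOpenImmersion_ι f
  obtain ⟨t, -, ht⟩ := (isCompact_univ (X := U)).elim_nhds_subcover (fun x => (V x : Set U))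
    fun x _ => (V x).isOpen.mem_nhds (hxV x)
  refine (t.finite_toSet.biUnion fun x _ => (?_ : (f ⁻¹' A ∩ V x).Finite)).subset fun y hy => ?_
  · have hinj : Set.InjOn f (V x : Set U) := by
      intro a ha b hb hab
      have := (V x).ι ≫ f |>.isOpenEmbedding.injective (a₁ := ⟨a, ha⟩) (a₂ := ⟨b, hb⟩) (by simpa)
      exact congrArg Subtype.val this
    exact Set.Finite.of_finite_image (hA.subset (Set.image_subset_iff.mpr Set.inter_subset_left))
      (hinj.mono Set.inter_subset_right)
  · obtain ⟨x, hx, hyx⟩ := Set.mem_iUnion₂.mp (ht (Set.mem_univ y))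
    exact Set.mem_iUnion₂.mpr ⟨x, hx, hy, hyx⟩

end LocalIso

section Opens

variable {X : Scheme.{u}} (V : X.Opens)

instance isNoetherian_opens [IsNoetherian X] : IsNoetherian (V : Scheme.{u}) where
  toCompactSpace := isCompact_iff_compactSpace.mp
    (TopologicalSpace.NoetherianSpace.isCompact (V : Set X))

instance isNormal_opens [IsNormal X] : IsNormal (V : Scheme.{u}) := .of_isLocalIso V.ι

theorem finite_support_of_compactSpace [CompactSpace X] {R : Type*} [Zero R]
    (D : AlgebraicCycle X R) : (Function.support D).Finite := by
  have := LocallyFiniteSupport.finite_inter_support_of_isCompact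
    (Function.locallyFinsupp.locallyFiniteSupport D) (isCompact_univ (X := X))
  rwa [Set.univ_inter] at this

/-- The algebraic cycle with the given coefficients, which have finite support. -/
def cycleOfFinite {R : Type*} [Zero R] (D : X → R) (hD : (Function.support D).Finite) :
    AlgebraicCycle X R where
  toFun := D
  supportWithinDomain' := Set.subset_univ _
  supportLocallyFiniteWithinDomain' _ _ :=
    ⟨Set.univ, Filter.univ_mem, hD.subset Set.inter_subset_right⟩

end Opens

/-! ### Comparison of `F`-splitness and `F`-regularity -/

section PartialMap

variable {Y Z : Scheme.{u}} (s : Y.PartialMap Z)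

instance nonempty_domain [Nonempty Y] : Nonempty s.domain := by
  obtain ⟨x, hx⟩ := s.dense_domain.nonempty
  exact ⟨⟨x, hx⟩⟩

instance nonempty_domain_toScheme [Nonempty Y] : Nonempty (s.domain : Scheme.{u}) :=
  nonempty_domain s

theorem coheight_ι {V : Y.Opens} (y : (V : Scheme.{u})) : coheight (V.ι y) = coheight y :=
  coheight_of_isLocalIso V.ι y

section SMax

variable {s} [CompactSpace Y] {Δ : AlgebraicCycle Y ℚ}

theorem coheight_eq_one_of_sMax_ne_zero {z : Z} (hz : sMax s Δ z ≠ 0) : coheight z = 1 := by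
  by_contra h
  exact hz (dif_neg fun h' => h h'.1)

theorem le_sMax [IsLocalIso s.hom] {y : (s.domain : Scheme.{u})} (hy : coheight (s.domain.ι y) = 1) :
    Δ (s.domain.ι y) ≤ sMax s Δ (s.hom y) := by
  have hmem : Δ (s.domain.ι y) ∈ coeffsOver s Δ (s.hom y) := ⟨y, hy, rfl, rfl⟩
  have hz : coheight (s.hom y) = 1 := by
    rw [coheight_of_isLocalIso, ← coheight_ι, hy]
  have heq : sMax s Δ (s.hom y) = _ := dif_pos ⟨hz, _, hmem⟩
  rw [heq]
  exact Finset.le_max' _ _ ((Set.Finite.mem_toFinset _).mpr hmem)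

theorem exists_sMax_eq [IsLocalIso s.hom] (hs : IsBig (Set.range s.hom)) {z : Z}
    (hz : coheight z = 1) : ∃ y : (s.domain : Scheme.{u}),
    coheight (s.domain.ι y) = 1 ∧ s.hom y = z ∧ Δ (s.domain.ι y) = sMax s Δ z := by
  have hmem : z ∈ Set.range s.hom := by
    by_contra h
    exact (hs z h).ne' hz
  obtain ⟨y, rfl⟩ := hmem
  have hy : coheight (s.domain.ι y) = 1 := by
    rw [coheight_ι, ← coheight_of_isLocalIso s.hom, hz]
  have heq : sMax s Δ (s.hom y) = _ := dif_pos ⟨hz, _, y, hy, rfl, rfl⟩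
  rw [heq]
  exact (coeffsOver_finite s Δ _).mem_toFinset.mp (Finset.max'_mem _ _)

theorem sMax_nonneg [IsLocalIso s.hom] (hs : IsBig (Set.range s.hom)) (hΔ : ∀ y, 0 ≤ Δ y) (z : Z) :
    0 ≤ sMax s Δ z := by
  by_cases hz : coheight z = 1
  · obtain ⟨y, -, -, hy⟩ := exists_sMax_eq (Δ := Δ) hs hz
    rw [← hy]
    exact hΔ _
  · by_contra h
    exact hz (coheight_eq_one_of_sMax_ne_zero fun h' => h h'.ge)

end SMax

theorem exists_ι_eq {V : Y.Opens} {y : Y} (hy : y ∈ V) : ∃ y' : (V : Scheme.{u}), V.ι y' = y :=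
  ⟨⟨y, hy⟩, rfl⟩

theorem ceilMul_apply (c : ℚ) (Δ : AlgebraicCycle Y ℚ) (x : Y) : ceilMul c Δ x = ⌈c * Δ x⌉ := rfl

theorem ceilMul_nonneg {c : ℚ} (hc : 0 ≤ c) {Δ : AlgebraicCycle Y ℚ} (hΔ : ∀ y, 0 ≤ Δ y) (y : Y) :
    0 ≤ ceilMul c Δ y :=
  Int.ceil_nonneg (mul_nonneg hc (hΔ y))

theorem ceilMul_mono {c : ℚ} (hc : 0 ≤ c) {Δ : AlgebraicCycle Y ℚ} {Δ' : AlgebraicCycle Z ℚ}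
    {y : Y} {z : Z} (h : Δ y ≤ Δ' z) : ceilMul c Δ y ≤ ceilMul c Δ' z :=
  Int.ceil_le_ceil (mul_le_mul_of_nonneg_left h hc)

variable {s}
variable [IsIntegral Y] [IsNoetherian Y] [IsIntegral Z] [IsNoetherian Z]
  [IsLocalIso s.hom] {p e : ℕ} {DY : Y → ℤ} {DZ : Z → ℤ}

/-- A big open subset contains all codimension-one points, and these are the only points that the
condition involves. -/
theorem pullbackForm_ι_iff (hs : IsBig (s.domain : Set Y)) {φ : Y.functionField →+ Y.functionField} :
    IsFrobeniusForm p e (fun y => DY (s.domain.ι y))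
      (pullbackForm s.domain.ι φ) ↔ IsFrobeniusForm p e DY φ := by
  refine ⟨fun h => h.of_pullback fun y hy => ?_, fun h => h.pullback fun y _ => le_rfl⟩
  by_cases hys : y ∈ s.domain
  · obtain ⟨y, rfl⟩ := exists_ι_eq hys
    exact ⟨y, rfl, le_rfl⟩
  · exact absurd hy (hs y hys).ne'

theorem exists_form_of_exists_form_image (hs : IsBig (s.domain : Set Y))
    (hD : ∀ y : (s.domain : Scheme.{u}), coheight (s.domain.ι y) = 1 →
      DY (s.domain.ι y) ≤ DZ (s.hom y))
    (h : ∃ φ : Z.functionField →+ Z.functionField, IsFrobeniusForm p e DZ φ ∧ φ 1 = 1) :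
    ∃ φ : Y.functionField →+ Y.functionField, IsFrobeniusForm p e DY φ ∧ φ 1 = 1 := by
  obtain ⟨φ, hφ, h1⟩ := h
  obtain ⟨ψ, hψ⟩ := (pullbackForm s.domain.ι).surjective (pullbackForm s.hom φ)
  refine ⟨ψ, (pullbackForm_ι_iff hs).mp ?_, ?_⟩
  · rw [hψ]
    exact hφ.pullback fun y hy => hD y (by rw [coheight_ι, hy])
  · rw [← pullbackForm_one s.domain.ι, hψ, pullbackForm_one, h1]

theorem exists_form_image_of_exists_form (hs : IsBig (s.domain : Set Y))
    (hD : ∀ z : Z, coheight z = 1 → ∃ y : (s.domain : Scheme.{u}),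
      s.hom y = z ∧ DZ z ≤ DY (s.domain.ι y))
    (h : ∃ φ : Y.functionField →+ Y.functionField, IsFrobeniusForm p e DY φ ∧ φ 1 = 1) :
    ∃ φ : Z.functionField →+ Z.functionField, IsFrobeniusForm p e DZ φ ∧ φ 1 = 1 := by
  obtain ⟨φ, hφ, h1⟩ := h
  obtain ⟨ψ, hψ⟩ := (pullbackForm s.hom).surjective (pullbackForm s.domain.ι φ)
  refine ⟨ψ, IsFrobeniusForm.of_pullback (f := s.hom)
    (DU := fun y => DY (s.domain.ι y)) ?_ hD, ?_⟩
  · rw [hψ]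
    exact (pullbackForm_ι_iff hs).mpr hφ
  · rw [← pullbackForm_one s.hom, hψ, pullbackForm_one, h1]

variable [IsNormal Y] [IsNormal Z] [Fact p.Prime] {Δ : AlgebraicCycle Y ℚ}

theorem prime_sub_one_nonneg (p : ℕ) [hp : Fact p.Prime] : (0 : ℚ) ≤ (p : ℚ) - 1 := by
  have : (1 : ℚ) ≤ p := by exact_mod_cast hp.out.one_le
  linarith

theorem prime_pow_sub_one_nonneg (p : ℕ) [hp : Fact p.Prime] (e : ℕ) :
    (0 : ℚ) ≤ (p : ℚ) ^ e - 1 := by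
  have : (1 : ℚ) ≤ (p : ℚ) ^ e := one_le_pow₀ (by exact_mod_cast hp.out.one_le)
  linarith

theorem isFSplit_iff (hΔ : ∀ y, 0 ≤ Δ y) : IsFSplit p Δ ↔
    ∃ φ : Y.functionField →+ Y.functionField,
      IsFrobeniusForm p 1 (ceilMul ((p : ℚ) - 1) Δ) φ ∧ φ 1 = 1 := by
  have h0 := ceilMul_nonneg (prime_sub_one_nonneg p) hΔ
  constructor
  · rintro ⟨σ, hσ⟩
    obtain ⟨φ, hφ, h1, -⟩ := FSplitting.IsDivisorSplitting.exists_isFrobeniusForm hσ h0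
    exact ⟨φ, hφ, h1⟩
  · rintro ⟨φ, hφ, h1⟩
    obtain ⟨σ, hσ, -⟩ := hφ.exists_fSplitting h1 h0
    exact ⟨σ, hσ⟩

theorem isFSplit_sMax_iff (hdom : IsBig (s.domain : Set Y)) (hran : IsBig (Set.range s.hom))
    (hΔ : ∀ y, 0 ≤ Δ y) : IsFSplit p Δ ↔ IsFSplit p (sMax s Δ) := by
  rw [isFSplit_iff hΔ, isFSplit_iff (sMax_nonneg hran hΔ)]
  constructor
  · refine exists_form_image_of_exists_form hdom fun z hz => ?_
    obtain ⟨y, -, hyz, hy⟩ := exists_sMax_eq (Δ := Δ) hran hz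
    exact ⟨y, hyz, ceilMul_mono (prime_sub_one_nonneg p) hy.ge⟩
  · exact exists_form_of_exists_form_image hdom fun y hy =>
      ceilMul_mono (prime_sub_one_nonneg p) (le_sMax hy)

theorem IsFRegular.of_sMax (hdom : IsBig (s.domain : Set Y))
    (hran : IsBig (Set.range s.hom)) (hΔ : ∀ y, 0 ≤ Δ y) (h : IsFRegular p (sMax s Δ)) :
    IsFRegular p Δ := by
  intro D hD hD0 hDne
  let Dq : AlgebraicCycle Y ℚ := cycleOfFinite (fun y => (D y : ℚ))
    ((finite_support_of_compactSpace D).subset fun y hy hy' => hy (by simp [hy']))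
  have hDq : ∀ y, Dq y = D y := fun y => rfl
  have hDq0 : ∀ y, 0 ≤ Dq y := fun y => by rw [hDq]; exact_mod_cast hD0 y
  -- Testing `F`-regularity of `sMax s Δ` against `sMax` of `D` is enough, since it dominates `D` at
  -- all codimension-one points of the domain. The passage through `ℚ` is only because `sMax` takes
  -- rational coefficients.
  let D' : AlgebraicCycle Z ℤ := ceilMul 1 (sMax s Dq)
  have hle : ∀ y : (s.domain : Scheme.{u}), coheight (s.domain.ι y) = 1 →
      D (s.domain.ι y) ≤ D' (s.hom y) := by
    intro y hy
    have h1 : Dq (s.domain.ι y) ≤ sMax s Dq (s.hom y) := le_sMax hy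
    rw [hDq] at h1
    have h2 : 1 * sMax s Dq (s.hom y) ≤ D' (s.hom y) := Int.le_ceil _
    rw [one_mul] at h2
    exact_mod_cast h1.trans h2
  have hD'0 : ∀ z, 0 ≤ D' z := ceilMul_nonneg zero_le_one (sMax_nonneg hran hDq0)
  obtain ⟨e, he, hsplit⟩ := h D' (fun z hz => by
      refine coheight_eq_one_of_sMax_ne_zero (s := s) (Δ := Dq) fun h0 => hz ?_
      rw [ceilMul_apply, h0, mul_zero, Int.ceil_zero]) hD'0 (fun h0 => by
      obtain ⟨y, hy⟩ : ∃ y, D y ≠ 0 := by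
        by_contra hne
        push Not at hne
        exact hDne (DFunLike.ext _ _ hne)
      have hys : y ∈ s.domain := by
        by_contra hys
        exact (hdom y hys).ne' (hD y hy)
      obtain ⟨y, rfl⟩ := exists_ι_eq hys
      have := hle y (hD _ hy)
      rw [h0] at this
      exact hy (le_antisymm this (hD0 _)))
  refine ⟨e, he, ?_⟩
  have hpos := prime_pow_sub_one_nonneg p e
  rw [splitsAlong_iff fun z => add_nonneg (ceilMul_nonneg hpos (sMax_nonneg hran hΔ) z)
    (hD'0 z)] at hsplit
  rw [splitsAlong_iff fun y => add_nonneg (ceilMul_nonneg hpos hΔ y) (hD0 y)]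
  exact exists_form_of_exists_form_image hdom
    (fun y hy => add_le_add (ceilMul_mono hpos (le_sMax hy)) (hle y hy)) hsplit

open Classical in
theorem IsFRegular.sMax (hdom : IsBig (s.domain : Set Y))
    (hran : IsBig (Set.range s.hom)) (hΔ : ∀ y, 0 ≤ Δ y) (h : IsFRegular p Δ) :
    IsFRegular p (sMax s Δ) := by
  intro D' hD' hD'0 hD'ne
  -- The test divisor on `Y` is the pullback of `D'`, extended by zero outside the domain. It is
  -- nonzero since the image of `s` contains every codimension-one point.
  let F : Y → ℤ := fun y => if hy : y ∈ s.domain then D' (s.hom ⟨y, hy⟩) else 0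
  have hF : ∀ y : (s.domain : Scheme.{u}), F (s.domain.ι y) = D' (s.hom y) := fun y => dif_pos y.2
  have hF' : ∀ y, y ∉ s.domain → F y = 0 := fun y hy => dif_neg hy
  let D : AlgebraicCycle Y ℤ := cycleOfFinite F (by
    refine ((finite_preimage_of_isLocalIso s.hom (finite_support_of_compactSpace D')).image
      s.domain.ι).subset fun y hy => ?_
    by_cases hys : y ∈ s.domain
    · obtain ⟨y, rfl⟩ := exists_ι_eq hys
      exact ⟨y, fun h0 => hy ((hF y).trans h0), rfl⟩
    · exact absurd (hF' y hys) hy)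
  have hD : ∀ y, D y = F y := fun y => rfl
  have hD0 : ∀ y, 0 ≤ D y := by
    intro y
    rw [hD]
    by_cases hys : y ∈ s.domain
    · obtain ⟨y, rfl⟩ := exists_ι_eq hys
      rw [hF]; exact hD'0 _
    · rw [hF' y hys]
  obtain ⟨e, he, hsplit⟩ := h D (fun y hy => by
      by_cases hys : y ∈ s.domain
      · obtain ⟨y, rfl⟩ := exists_ι_eq hys
        rw [hD, hF] at hy
        have := hD' _ hy
        rw [coheight_of_isLocalIso] at this
        rw [← this, ← coheight_ι]
      · exact absurd (hF' y hys) hy) hD0 (fun h0 => by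
      obtain ⟨z, hz⟩ : ∃ z, D' z ≠ 0 := by
        by_contra hne
        push Not at hne
        exact hD'ne (DFunLike.ext _ _ hne)
      obtain ⟨y, -, rfl, -⟩ := exists_sMax_eq (Δ := Δ) hran (hD' z hz)
      rw [← hF, ← hD, h0] at hz
      exact hz rfl)
  refine ⟨e, he, ?_⟩
  have hpos := prime_pow_sub_one_nonneg p e
  rw [splitsAlong_iff fun y => add_nonneg (ceilMul_nonneg hpos hΔ y) (hD0 y)] at hsplit
  rw [splitsAlong_iff fun z => add_nonneg (ceilMul_nonneg hpos (sMax_nonneg hran hΔ) z)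
    (hD'0 z)]
  refine exists_form_image_of_exists_form hdom (fun z hz => ?_) hsplit
  obtain ⟨y, -, rfl, hy⟩ := exists_sMax_eq (Δ := Δ) hran hz
  exact ⟨y, rfl, add_le_add (ceilMul_mono hpos hy.ge) (by rw [hD, hF])⟩

end PartialMap

/-! ### Ideals of scheme-theoretic images and of reduced subschemes -/

section IdealSheaf

variable {U W : Scheme.{u}}

theorem app_res_apply (f : U ⟶ W) {V V' : W.Opens} (h : V' ≤ V) (h' : f ⁻¹ᵁ V' ≤ f ⁻¹ᵁ V)
    (a : Γ(W, V)) : U.presheaf.map (homOfLE h').op (f.app V a) =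
      f.app V' (W.presheaf.map (homOfLE h).op a) :=
  (ConcreteCategory.congr_hom (f.naturality (homOfLE h).op) a).symm

/-- The ideal consists of the functions that vanish on the closed subscheme of `J`, and vanishing is
local on that subscheme. -/
theorem mem_ideal_map_iff (f : U ⟶ W) [QuasiCompact f] (J : U.IdealSheafData) (V : W.affineOpens)
    (a : Γ(W, V)) : a ∈ (J.map f).ideal V ↔ ∀ (V' : U.affineOpens) (h : (V' : U.Opens) ≤ f ⁻¹ᵁ V),
      U.presheaf.map (homOfLE h).op (f.app V a) ∈ J.ideal V' := by
  have h1 : a ∈ (J.map f).ideal V ↔ J.subschemeι.app (f ⁻¹ᵁ V) (f.app V a) = 0 := by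
    rw [Scheme.IdealSheafData.map, Scheme.Hom.ker_apply, RingHom.mem_ker, Scheme.Hom.comp_app]
    rfl
  have h2 : ∀ (V' : U.affineOpens) (h : (V' : U.Opens) ≤ f ⁻¹ᵁ V),
      U.presheaf.map (homOfLE h).op (f.app V a) ∈ J.ideal V' ↔
      J.subscheme.presheaf.map (homOfLE
        (J.subschemeι.preimage_mono h : J.subschemeι ⁻¹ᵁ V' ≤ J.subschemeι ⁻¹ᵁ (f ⁻¹ᵁ V))).op
        (J.subschemeι.app (f ⁻¹ᵁ V) (f.app V a)) = 0 := by
    intro V' h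
    rw [← J.ker_subschemeι_app, RingHom.mem_ker, app_res_apply]
  rw [h1]
  constructor
  · intro h0 V' h
    rw [h2, h0, map_zero]
  · intro H
    refine J.subscheme.sheaf.eq_of_locally_eq'
      (fun V' : {V' : U.affineOpens // (V' : U.Opens) ≤ f ⁻¹ᵁ V} => J.subschemeι ⁻¹ᵁ V'.1) _
      (fun V' => homOfLE (J.subschemeι.preimage_mono V'.2)) ?_ _ _ fun V' => ?_
    · intro x hx
      obtain ⟨_, ⟨A, hA, rfl⟩, hxA, hAV⟩ := U.isBasis_affineOpens.exists_subset_of_mem_open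
        (show J.subschemeι x ∈ f ⁻¹ᵁ V from hx) (f ⁻¹ᵁ V).isOpen
      exact TopologicalSpace.Opens.mem_iSup.mpr ⟨⟨⟨A, hA⟩, hAV⟩, hxA⟩
    · exact ((h2 V'.1 V'.2).mp (H V'.1 V'.2)).trans (map_zero _).symm

theorem exists_genericPoints_mem {T : Scheme.{u}} {O : T.Opens} (hO : O ≠ ⊥) :
    ∃ c ∈ genericPoints T, c ∈ O := by
  obtain ⟨x, hx⟩ := O.ne_bot_iff_nonempty.mp hO
  have hcl : closure (genericPoints T) = Set.univ := genericPoints.closure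
  obtain ⟨c, hcO, hc⟩ := mem_closure_iff.mp (hcl.ge (Set.mem_univ x)) O O.isOpen hx
  exact ⟨c, hc, hcO⟩

/-- On a reduced scheme a function is zero when its nonvanishing locus is empty, and a nonempty open
subset contains the generic point of some component. -/
theorem mem_ker_ideal_iff {T : Scheme.{u}} [IsReduced T] (h : T ⟶ W) [QuasiCompact h]
    (V : W.affineOpens) (a : Γ(W, V)) :
    a ∈ h.ker.ideal V ↔ ∀ c ∈ genericPoints T, h c ∉ W.basicOpen a := by
  rw [Scheme.Hom.ker_apply, RingHom.mem_ker]
  have key : h ⁻¹ᵁ W.basicOpen a = ⊥ ↔ h.app V a = 0 := by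
    rw [Scheme.preimage_basicOpen]
    exact basicOpen_eq_bot_iff _
  constructor
  · intro h0 c _ hc
    have : c ∈ h ⁻¹ᵁ W.basicOpen a := hc
    rw [key.mpr h0] at this
    exact this
  · intro H
    rw [← key]
    by_contra hne
    obtain ⟨c, hc, hcO⟩ := exists_genericPoints_mem hne
    exact H c hc hcO

theorem isReduced_subscheme (J : U.IdealSheafData)
    (hJ : ∀ V : U.affineOpens, (J.ideal V).IsRadical) : IsReduced J.subscheme := by
  have : ∀ V, IsReduced (J.subschemeCover.openCover.X V) := fun (V : U.affineOpens) => by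
    have h : _root_.IsReduced (Γ(U, V) ⧸ J.ideal V) :=
      (Ideal.isRadical_iff_quotient_reduced _).mp (hJ V)
    exact inferInstanceAs (IsReduced (Spec (.of (Γ(U, V) ⧸ J.ideal V))))
  exact IsReduced.of_openCover _ J.subschemeCover.openCover

theorem isReduced_subscheme_comap (f : U ⟶ W) [IsOpenImmersion f] (J : W.IdealSheafData)
    [IsReduced J.subscheme] : IsReduced (J.comap f).subscheme := by
  have : IsReduced (Limits.pullback f J.subschemeι) :=
    isReduced_of_isOpenImmersion (Limits.pullback.snd f J.subschemeι)
  exact isReduced_of_isOpenImmersion (J.comapIso f).hom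

end IdealSheaf

theorem subsingleton_section {X : Scheme.{u}} {V : X.Opens} (hV : ¬ Nonempty V) : Subsingleton Γ(X, V) := by
  have : V = ⊥ := by
    ext x
    simpa using fun hx => hV ⟨⟨x, hx⟩⟩
  subst this
  infer_instance

/-! ### Compatibility with closed subschemes, on the function field -/

section FormCompatible

variable {X : Scheme.{u}} [IsIntegral X]

/-- An endomorphism of the function field is compatible with a closed subscheme if it maps local
equations of the subscheme to local equations of the subscheme. -/
def FormCompatible (φ : X.functionField →+ X.functionField) (I : X.IdealSheafData) : Prop :=
  ∀ (V : X.affineOpens) [Nonempty (V : X.Opens)] (f : Γ(X, V)), f ∈ I.ideal V →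
    ∃ g ∈ I.ideal V, X.germToFunctionField V g = φ (X.germToFunctionField V f)

theorem FormCompatible.mem {φ : X.functionField →+ X.functionField} {I : X.IdealSheafData}
    (h : FormCompatible φ I) {V : X.affineOpens} [Nonempty (V : X.Opens)] {f g : Γ(X, V)}
    (hf : f ∈ I.ideal V) (hg : X.germToFunctionField V g = φ (X.germToFunctionField V f)) :
    g ∈ I.ideal V := by
  obtain ⟨g', hg', h'⟩ := h V f hf
  rwa [X.germToFunctionField_injective V (hg.trans h'.symm)]

theorem isCompatible_iff {p : ℕ} {φ : X.functionField →+ X.functionField} {σ : FSplitting p X}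
    (hσ : ∀ (V : X.Opens) [Nonempty V] (f : Γ(X, V)),
        X.germToFunctionField V (σ.app V f) = φ (X.germToFunctionField V f))
    {I : X.IdealSheafData} : σ.IsCompatible I ↔ FormCompatible φ I := by
  constructor
  · exact fun h V _ f hf => ⟨_, h V f hf, hσ V f⟩
  · intro h V f hf
    by_cases hV : Nonempty (V : X.Opens)
    · exact h.mem hf (hσ V f)
    · have := subsingleton_section hV
      rw [Subsingleton.elim (σ.app V f) 0]
      exact zero_mem _

/-- Being a unit at `x` is expressed inside the function field so that it can be carried along a
local isomorphism. -/
theorem mem_basicOpen_iff {V : X.Opens} [Nonempty V] {x : X} (hx : x ∈ V) (g : Γ(X, V)) :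
    x ∈ X.basicOpen g ↔ X.germToFunctionField V g ≠ 0 ∧
      (X.germToFunctionField V g)⁻¹ ∈ stalkRange x := by
  rw [Scheme.mem_basicOpen _ _ x hx, ← Scheme.algebraMap_germ_eq_germToFunctionField X hx g]
  set a := X.presheaf.germ V x hx g
  have hinj : Function.Injective (algebraMap (X.presheaf.stalk x) X.functionField) :=
    IsFractionRing.injective _ _
  constructor
  · intro ha
    refine ⟨fun h0 => ?_, ⟨↑ha.unit⁻¹, ?_⟩⟩
    · rw [map_eq_zero_iff _ hinj] at h0
      rw [h0] at ha
      exact not_isUnit_zero ha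
    · refine eq_inv_of_mul_eq_one_left ?_
      rw [← map_mul, IsUnit.val_inv_mul, map_one]
  · rintro ⟨h0, b, hb⟩
    refine IsUnit.of_mul_eq_one b (hinj ?_)
    rw [map_mul, hb, map_one, mul_inv_cancel₀ h0]

variable [IsNoetherian X] [IsNormal X] {p : ℕ} [hp : Fact p.Prime]

theorem isFSplitCompatibly_iff {Δ : AlgebraicCycle X ℚ} (hΔ : ∀ y, 0 ≤ Δ y)
    {I : X.IdealSheafData} : IsFSplitCompatibly p Δ I ↔
    ∃ φ : X.functionField →+ X.functionField,
      IsFrobeniusForm p 1 (ceilMul ((p : ℚ) - 1) Δ) φ ∧ φ 1 = 1 ∧ FormCompatible φ I := by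
  have h0 := ceilMul_nonneg (prime_sub_one_nonneg p) hΔ
  constructor
  · rintro ⟨σ, hσ, hI⟩
    obtain ⟨φ, hφ, h1, h⟩ := FSplitting.IsDivisorSplitting.exists_isFrobeniusForm hσ h0
    exact ⟨φ, hφ, h1, (isCompatible_iff h).mp hI⟩
  · rintro ⟨φ, hφ, h1, hI⟩
    obtain ⟨σ, hσ, h⟩ := hφ.exists_fSplitting h1 h0
    exact ⟨σ, hσ, (isCompatible_iff h).mpr hI⟩

/-- If `a ^ p` lies in the ideal, then so does `σ (a ^ p) = a`; iterate. This is what makes the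
reducedness hypothesis (i) applicable. -/
theorem isRadical_of_isFSplitCompatibly {Δ : AlgebraicCycle X ℚ} {I : X.IdealSheafData}
    (h : IsFSplitCompatibly p Δ I) (V : X.affineOpens) : (I.ideal V).IsRadical := by
  obtain ⟨σ, -, hI⟩ := h
  have key : ∀ (m : ℕ) (a : Γ(X, V)), a ^ p ^ m ∈ I.ideal V → a ∈ I.ideal V := by
    intro m
    induction m with
    | zero => intro a ha; simpa using ha
    | succ m ih =>
      intro a ha
      rw [pow_succ, pow_mul] at ha
      have := hI V _ ha
      rw [σ.app_pow] at this
      exact ih a this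
  rintro a ⟨n, hn⟩
  exact key n a (Ideal.pow_mem_of_pow_mem _ hn (Nat.lt_pow_self hp.out.one_lt).le)

end FormCompatible

/-! ### Moving compatibility along local isomorphisms -/

section Transfer

variable {U W : Scheme.{u}} [IsIntegral U] [IsIntegral W]

theorem FormCompatible.comap (f : U ⟶ W) [IsOpenImmersion f]
    {φ : W.functionField →+ W.functionField} {I : W.IdealSheafData} (h : FormCompatible φ I) :
    FormCompatible (pullbackForm f φ) (I.comap f) := by
  intro V hV a ha
  have hV' : Nonempty (f ''ᵁ (V : U.Opens)) := by
    obtain ⟨x, hx⟩ := hV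
    exact ⟨⟨f x, x, hx, rfl⟩⟩
  have hV'' : Nonempty (f ⁻¹ᵁ f ''ᵁ (V : U.Opens)) := by rwa [f.preimage_image_eq]
  rw [Scheme.IdealSheafData.ideal_comap_of_isOpenImmersion, Ideal.mem_comap] at ha
  obtain ⟨b, hb, hbφ⟩ := h ⟨f ''ᵁ V, _⟩ _ ha
  have key : ∀ c : Γ(W, f ''ᵁ V), U.germToFunctionField V ((f.appIso V).hom c) =
      functionFieldEquiv f (W.germToFunctionField (f ''ᵁ V) c) := by
    intro c
    rw [functionFieldEquiv_germ, Scheme.Hom.appIso_hom]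
    exact U.presheaf.germ_res_apply (eqToHom _) _ _ _
  refine ⟨(f.appIso V).hom b, ?_, ?_⟩
  · rw [Scheme.IdealSheafData.ideal_comap_of_isOpenImmersion, Ideal.mem_comap]
    simpa using hb
  · have ha' := key ((f.appIso V).inv a)
    rw [key]
    have : (f.appIso V).hom ((f.appIso V).inv a) = a := by simp
    rw [this] at ha'
    rw [ha', pullbackForm_apply]
    exact congrArg _ hbφ

theorem functionFieldEquiv_germ_res (f : U ⟶ W) [IsLocalIso f] {V : W.Opens} [Nonempty V]
    {V' : U.Opens} [Nonempty V'] (h : V' ≤ f ⁻¹ᵁ V) (a : Γ(W, V)) :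
    U.germToFunctionField V' (U.presheaf.map (homOfLE h).op (f.app V a)) =
      functionFieldEquiv f (W.germToFunctionField V a) := by
  have : Nonempty (f ⁻¹ᵁ V) := ⟨⟨_, h (Classical.arbitrary V').2⟩⟩
  rw [germ_map_homOfLE, functionFieldEquiv_germ]

variable [IsNoetherian U] [IsNoetherian W] [IsNormal W] {p e : ℕ} {D : AlgebraicCycle W ℤ}

theorem FormCompatible.map (f : U ⟶ W) [IsLocalIso f]
    {φ : W.functionField →+ W.functionField} {J : U.IdealSheafData}
    (hφ : IsFrobeniusForm p e D φ) (hD : ∀ z, 0 ≤ D z)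
    (h : FormCompatible (pullbackForm f φ) J) : FormCompatible φ (J.map f) := by
  have : QuasiCompact f := quasiCompact_of_noetherianSpace_source f
  intro V hV a ha
  obtain ⟨g, hg⟩ := hφ.exists_section V (germ_mem_divisorSections hD V a)
  refine ⟨g, ?_, hg⟩
  rw [mem_ideal_map_iff] at ha ⊢
  intro V' hV'
  by_cases hne : Nonempty (V' : U.Opens)
  · refine h.mem (ha V' hV') ?_
    rw [functionFieldEquiv_germ_res, functionFieldEquiv_germ_res, pullbackForm_apply, hg]
  · have := subsingleton_section hne
    rw [Subsingleton.elim (U.presheaf.map (homOfLE hV').op (f.app V g)) 0]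
    exact zero_mem _

/-- Suppose `a ∈ J` but `g = φ a` is a unit at the point `x` generic in a component. Descend `a` to
`a'` near `f x`, and pick `b`, a unit at `f x`, vanishing on the images of the generic points that
do not map to `f x`. Then `b a'`, and so `b ^ p a'`, lies in the ideal of the image, hence so does
`φ (b ^ p a') = b φ a'`; but this is a unit at `f x`. -/
theorem FormCompatible.of_map (f : U ⟶ W) [IsLocalIso f] {DU : AlgebraicCycle U ℤ}
    {φ : W.functionField →+ W.functionField} {J : U.IdealSheafData} [IsReduced J.subscheme]
    [IsNormal U] (hp : 0 < p) (hφ : IsFrobeniusForm p 1 DU (pullbackForm f φ))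
    (hφW : IsFrobeniusForm p 1 D φ) (hD : ∀ z, 0 ≤ DU z)
    (hJ : ∀ c ∈ genericPoints J.subscheme, ∀ c' ∈ genericPoints J.subscheme,
      (J.subschemeι ≫ f) c ∈ closure {(J.subschemeι ≫ f) c'} →
        (J.subschemeι ≫ f) c = (J.subschemeι ≫ f) c')
    (h : FormCompatible φ (J.map f)) : FormCompatible (pullbackForm f φ) J := by
  have : QuasiCompact f := quasiCompact_of_noetherianSpace_source f
  have : TopologicalSpace.NoetherianSpace J.subscheme :=
    J.subschemeι.isEmbedding.isInducing.noetherianSpace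
  have hfin : (genericPoints J.subscheme).Finite :=
    genericPoints.finite TopologicalSpace.NoetherianSpace.finite_irreducibleComponents
  have hJι : J.subschemeι.ker = J := J.ker_subschemeι
  have hmem : ∀ (V : U.affineOpens) (a : Γ(U, V)), a ∈ J.ideal V ↔
      ∀ c ∈ genericPoints J.subscheme, J.subschemeι c ∉ U.basicOpen a := by
    intro V a
    rw [← mem_ker_ideal_iff, hJι]
  have hmem' : ∀ (V : W.affineOpens) (a : Γ(W, V)), a ∈ (J.map f).ideal V ↔
      ∀ c ∈ genericPoints J.subscheme, (J.subschemeι ≫ f) c ∉ W.basicOpen a :=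
    fun V a => mem_ker_ideal_iff _ V a
  set θ := functionFieldEquiv f
  intro V hV a ha
  obtain ⟨g, hg⟩ := hφ.exists_section V (germ_mem_divisorSections hD V a)
  refine ⟨g, (hmem V g).mpr fun c hc hcg => ?_, hg⟩
  set x := J.subschemeι c
  have hxV : x ∈ (V : U.Opens) := U.basicOpen_le g hcg
  have hcx : (J.subschemeι ≫ f) c = f x := by simp [x]
  have hxa : x ∉ U.basicOpen a := (hmem V a).mp ha c hc
  have haW : θ.symm (U.germToFunctionField V a) ∈ stalkRange (f x) := by
    rw [← functionFieldEquiv_mem_stalkRange]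
    change θ _ ∈ _
    rw [RingEquiv.apply_symm_apply]
    exact germ_mem_stalkRange hxV a
  obtain ⟨A, hxA, -, a', hA, ha'⟩ := exists_germ_of_mem_stalkRange haW ⊤ trivial
  have hneA : Nonempty A := ⟨⟨_, hxA⟩⟩
  have hθa : θ (W.germToFunctionField A a') = U.germToFunctionField V a := by
    rw [ha', RingEquiv.apply_symm_apply]
  have hinv : ∀ k : W.functionField, (θ k)⁻¹ ∈ stalkRange x ↔ k⁻¹ ∈ stalkRange (f x) := by
    intro k
    rw [← map_inv₀, functionFieldEquiv_mem_stalkRange]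
  have hxa' : f x ∉ W.basicOpen a' := by
    intro hmem
    refine hxa ((mem_basicOpen_iff hxV a).mpr ?_)
    obtain ⟨h0, h1⟩ := (mem_basicOpen_iff hxA a').mp hmem
    rw [← hθa, hinv]
    exact ⟨(map_ne_zero_iff _ θ.injective).mpr h0, h1⟩
  -- The complement of the closures of the other image points. It contains `f x` because images are
  -- not nested, and it is open because there are finitely many components.
  let O : W.Opens := ⟨(⋃ c' ∈ {c' ∈ genericPoints J.subscheme | (J.subschemeι ≫ f) c' ≠ f x},
    closure {(J.subschemeι ≫ f) c'})ᶜ, by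
      rw [isOpen_compl_iff]
      exact (hfin.subset (Set.sep_subset _ _)).isClosed_biUnion fun _ _ => isClosed_closure⟩
  have hxO : f x ∈ O := by
    intro hx
    obtain ⟨c', ⟨hc', hne⟩, hx⟩ := Set.mem_iUnion₂.mp hx
    rw [← hcx] at hx hne
    exact hne (hJ c hc c' hc' hx).symm
  obtain ⟨b, hbO, hxb⟩ := hA.exists_basicOpen_le ⟨f x, hxO⟩ hxA
  have hba : b * a' ∈ (J.map f).ideal ⟨A, hA⟩ := by
    rw [hmem']
    intro c' hc' hmem
    rw [Scheme.basicOpen_mul] at hmem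
    -- Several components may map to `f x`. At all of them `a'` vanishes, since the same local ring
    -- at `f x` decides; at the remaining ones `b` vanishes.
    by_cases hne : (J.subschemeι ≫ f) c' = f x
    · rw [hne] at hmem
      exact hxa' hmem.2
    · exact hbO hmem.1 (Set.mem_iUnion₂.mpr ⟨c', ⟨hc', hne⟩, subset_closure rfl⟩)
  -- A `p`-th power is needed for the factor to come out of the `p⁻¹`-linear map as `b`.
  have hbpa : b ^ p * a' ∈ (J.map f).ideal ⟨A, hA⟩ := by
    obtain ⟨n, rfl⟩ := Nat.exists_eq_add_of_lt hp
    rw [zero_add, pow_succ, mul_assoc]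
    exact Ideal.mul_mem_left _ _ hba
  obtain ⟨g', hg', hφg'⟩ := h ⟨A, hA⟩ _ hbpa
  rw [map_mul, map_pow] at hφg'
  have h1 := hφW.map_pow_mul (W.germToFunctionField A b) (W.germToFunctionField A a')
  rw [pow_one] at h1
  rw [h1] at hφg'
  have h2 : θ (W.germToFunctionField A g') =
      θ (W.germToFunctionField A b) * U.germToFunctionField V g := by
    rw [hφg', hg, ← hθa, map_mul, pullbackForm_apply]
  obtain ⟨hb0, hb⟩ := (mem_basicOpen_iff hxA b).mp hxb
  obtain ⟨hg0, hgx⟩ := (mem_basicOpen_iff hxV g).mp hcg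
  refine (hmem' ⟨A, hA⟩ g').mp hg' c hc ?_
  rw [hcx]
  refine (mem_basicOpen_iff hxA g').mpr ⟨?_, ?_⟩
  · rw [← map_ne_zero_iff _ θ.injective, h2]
    exact mul_ne_zero ((map_ne_zero_iff _ θ.injective).mpr hb0) hg0
  · rw [← hinv, h2, mul_inv]
    exact mul_mem ((hinv _).mpr hb) hgx

end Transfer

/-! ### Comparison of compatible splittings -/

section Separation

variable {Y Z : Scheme.{u}} {s : Y.PartialMap Z} [IsIntegral Y] [IsNoetherian Y] [IsNormal Y]
  [IsIntegral Z] [IsNoetherian Z] [IsNormal Z] [IsLocalIso s.hom] {p : ℕ} [hp : Fact p.Prime]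
  {Δ : AlgebraicCycle Y ℚ} {I : Y.IdealSheafData}

theorem IsFSplitCompatibly.sMax (hdom : IsBig (s.domain : Set Y))
    (hran : IsBig (Set.range s.hom)) (hΔ : ∀ y, 0 ≤ Δ y) (h : IsFSplitCompatibly p Δ I) :
    IsFSplitCompatibly p (sMax s Δ) (imageClosure s I) := by
  have hΔ' := sMax_nonneg hran hΔ
  have hpos := prime_sub_one_nonneg p
  obtain ⟨φ, hφ, h1, hI⟩ := (isFSplitCompatibly_iff hΔ).mp h
  obtain ⟨ψ, hψ⟩ := (pullbackForm s.hom).surjective (pullbackForm s.domain.ι φ)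
  have hψZ : IsFrobeniusForm p 1 (ceilMul ((p : ℚ) - 1) (FSep.sMax s Δ)) ψ := by
    refine IsFrobeniusForm.of_pullback (f := s.hom)
      (DU := fun y => ceilMul ((p : ℚ) - 1) Δ (s.domain.ι y)) ?_ fun z hz => ?_
    · rw [hψ]
      exact (pullbackForm_ι_iff hdom).mpr hφ
    · obtain ⟨y, -, hyz, hy⟩ := exists_sMax_eq (Δ := Δ) hran hz
      exact ⟨y, hyz, ceilMul_mono hpos hy.ge⟩
  refine (isFSplitCompatibly_iff hΔ').mpr ⟨ψ, hψZ, ?_, ?_⟩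
  · rw [← pullbackForm_one s.hom, hψ, pullbackForm_one, h1]
  · refine FormCompatible.map s.hom hψZ (ceilMul_nonneg hpos hΔ') ?_
    rw [hψ]
    exact hI.comap s.domain.ι

theorem HasUnnestedImages.eq_of_mem_closure {Y Z : Scheme.{u}} {s : Y.PartialMap Z}
    {I : Y.IdealSheafData} (h : HasUnnestedImages s I)
    {c c' : (domainPart s I).subscheme} (hc : c ∈ genericPoints (domainPart s I).subscheme)
    (hc' : c' ∈ genericPoints (domainPart s I).subscheme)
    (hcc' : imageMap s I c ∈ closure {imageMap s I c'}) : imageMap s I c = imageMap s I c' := by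
  have key : ∀ c, closure (imageMap s I '' closure {c}) = closure {imageMap s I c} := by
    intro c
    rw [closure_image_closure (imageMap s I).continuous, Set.image_singleton]
  have h1 := h _ hc _ hc'
  rw [key, key] at h1
  have h2 : closure {imageMap s I c} ⊆ closure {imageMap s I c'} :=
    closure_minimal (Set.singleton_subset_iff.mpr hcc') isClosed_closure
  have h3 : closure {imageMap s I c'} ⊆ closure {imageMap s I c} := by
    by_contra h3
    exact h1 ⟨h2, h3⟩
  exact (specializes_iff_mem_closure.mpr (h3 (subset_closure rfl))).antisymm
    (specializes_iff_mem_closure.mpr hcc') |>.eq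

theorem IsFSplitCompatibly.of_sMax (hdom : IsBig (s.domain : Set Y))
    (hran : IsBig (Set.range s.hom)) (hΔ : ∀ y, 0 ≤ Δ y) (hI : domainClosure s I = I)
    (hred : IsReduced (imageClosure s I).subscheme → IsReduced I.subscheme)
    (hnest : HasUnnestedImages s I)
    (h : IsFSplitCompatibly p (FSep.sMax s Δ) (imageClosure s I)) : IsFSplitCompatibly p Δ I := by
  have hpos := prime_sub_one_nonneg p
  -- The compatible image closure is automatically reduced, so (i) yields reducedness of `S`.
  have : IsReduced I.subscheme := hred (isReduced_subscheme _ (isRadical_of_isFSplitCompatibly h))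
  have : IsReduced (domainPart s I).subscheme := isReduced_subscheme_comap s.domain.ι I
  obtain ⟨φ, hφ, h1, hφI⟩ := (isFSplitCompatibly_iff (sMax_nonneg hran hΔ)).mp h
  let DU : AlgebraicCycle s.domain ℤ := cycleOfFinite
    (fun y => ceilMul ((p : ℚ) - 1) Δ (s.domain.ι y)) ((finite_preimage_of_isLocalIso s.domain.ι
      (finite_support_of_compactSpace (ceilMul ((p : ℚ) - 1) Δ))))
  have hU : IsFrobeniusForm p 1 DU (pullbackForm s.hom φ) := hφ.pullback fun y hy =>
    ceilMul_mono hpos (le_sMax (by rw [coheight_ι, hy]))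
  have hUI := FormCompatible.of_map s.hom hp.out.pos hU hφ (fun y => ceilMul_nonneg hpos hΔ _)
    (fun c hc c' hc' => hnest.eq_of_mem_closure hc hc') hφI
  obtain ⟨ψ, hψ⟩ := (pullbackForm s.domain.ι).surjective (pullbackForm s.hom φ)
  rw [← hψ] at hUI hU
  have hψY := (pullbackForm_ι_iff (DY := ceilMul ((p : ℚ) - 1) Δ) hdom).mp hU
  refine (isFSplitCompatibly_iff hΔ).mpr ⟨ψ, hψY, ?_, ?_⟩
  · rw [← pullbackForm_one s.domain.ι, hψ, pullbackForm_one, h1]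
  -- As `S` is the closure of `U ∩ S`, its ideal is a pushforward from `U`, and compatibility over
  -- `U` is enough.
  · rw [← hI]
    exact FormCompatible.map s.domain.ι hψY (ceilMul_nonneg hpos hΔ) hUI

end Separation

/-! ### Local rings as subrings of the function field -/

section ValuationLike

variable {X : Scheme.{u}} [IsIntegral X]

/-- In codimension one the local ring is a discrete valuation ring; in codimension zero it is the
whole function field. -/
theorem mem_or_inv_mem_stalkRange [IsLocallyNoetherian X] [IsNormal X] {x : X}
    (hx : coheight x ≤ 1) (g : X.functionField) : g ∈ stalkRange x ∨ g⁻¹ ∈ stalkRange x := by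
  by_cases h1 : coheight x = 1
  · have := isDiscreteValuationRing_stalk h1
    rcases ValuationRing.isInteger_or_isInteger (X.presheaf.stalk x) g with h | h
    · exact Or.inl h
    · exact Or.inr h
  · have h0 : coheight x = 0 := by
      rcases lt_or_eq_of_le hx with h | h
      · exact Order.lt_one_iff.mp h
      · exact absurd h h1
    obtain rfl := eq_genericPoint_of_coheight_eq_zero h0
    left
    obtain ⟨V, hV, a, rfl⟩ := X.presheaf.exists_germ_eq g
    have : Nonempty V := ⟨⟨_, hV⟩⟩
    exact germ_mem_stalkRange hV a

/-- The local ring at a point of an integral scheme is isomorphic to its image in the function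
field. -/
noncomputable def stalkRangeEquiv (x : X) : X.presheaf.stalk x ≃+* stalkRange x :=
  RingEquiv.ofBijective (algebraMap (X.presheaf.stalk x) X.functionField).rangeRestrict
    ⟨fun _ _ h => IsFractionRing.injective (X.presheaf.stalk x) X.functionField
      (congrArg Subtype.val h), RingHom.rangeRestrict_surjective _⟩

theorem coe_stalkRangeEquiv (x : X) (a : X.presheaf.stalk x) :
    (stalkRangeEquiv x a : X.functionField) = algebraMap _ X.functionField a := rfl

/-- Points of an integral scheme with the same local ring inside the function field have isomorphic
local rings. -/
noncomputable def stalkEquivOfEq {x y : X} (h : stalkRange x = stalkRange y) :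
    X.presheaf.stalk x ≃+* X.presheaf.stalk y :=
  ((stalkRangeEquiv x).trans (RingEquiv.subringCongr h)).trans (stalkRangeEquiv y).symm

theorem algebraMap_stalkEquivOfEq {x y : X} (h : stalkRange x = stalkRange y)
    (a : X.presheaf.stalk x) :
    algebraMap _ X.functionField (stalkEquivOfEq h a) = algebraMap _ X.functionField a := by
  rw [← coe_stalkRangeEquiv, stalkEquivOfEq, RingEquiv.trans_apply, RingEquiv.apply_symm_apply]
  rfl

theorem coheight_eq_of_stalkRange_eq {x y : X} (h : stalkRange x = stalkRange y) :
    coheight x = coheight y := by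
  have h := ringKrullDim_eq_of_ringEquiv (stalkEquivOfEq h)
  rw [ringKrullDim_stalk_eq_coheight, ringKrullDim_stalk_eq_coheight] at h
  exact_mod_cast h

/-- A choice of a point among all points with the same local ring inside the function field. -/
noncomputable def stalkRep (x : X) : X := (Quotient.mk (Setoid.ker (stalkRange (X := X))) x).out

theorem stalkRange_stalkRep (x : X) : stalkRange (stalkRep x) = stalkRange x :=
  Quotient.mk_out (s := Setoid.ker (stalkRange (X := X))) x

theorem stalkRep_eq_of_stalkRange_eq {x y : X} (h : stalkRange x = stalkRange y) :
    stalkRep x = stalkRep y :=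
  congrArg Quotient.out (Quotient.sound (s := Setoid.ker (stalkRange (X := X))) h)

theorem stalkRep_genericPoint : stalkRep (genericPoint X) = genericPoint X :=
  eq_genericPoint_of_coheight_eq_zero <| by
    rw [coheight_eq_of_stalkRange_eq (stalkRange_stalkRep _), coheight_genericPoint]

end ValuationLike

/-! ### The diagonal and a separated open subscheme -/

section Diagonal

open Limits

variable {Y B : Scheme.{u}} (f : Y ⟶ B)

/-- The open immersion `V ×_B V → Y ×_B Y` for an open subscheme `V` of `Y`. -/
noncomputable def prodMap (V : Y.Opens) :
    pullback (V.ι ≫ f) (V.ι ≫ f) ⟶ pullback f f :=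
  pullback.map (V.ι ≫ f) (V.ι ≫ f) f f V.ι V.ι (𝟙 B) (by simp) (by simp)

instance (V : Y.Opens) : IsOpenImmersion (prodMap f V) := by
  unfold prodMap
  infer_instance

theorem prodMap_fst (V : Y.Opens) : prodMap f V ≫ pullback.fst f f =
    pullback.fst (V.ι ≫ f) (V.ι ≫ f) ≫ V.ι :=
  pullback.lift_fst _ _ _

theorem prodMap_snd (V : Y.Opens) : prodMap f V ≫ pullback.snd f f =
    pullback.snd (V.ι ≫ f) (V.ι ≫ f) ≫ V.ι :=
  pullback.lift_snd _ _ _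

theorem diagonal_prodMap (V : Y.Opens) :
    pullback.diagonal (V.ι ≫ f) ≫ prodMap f V = V.ι ≫ pullback.diagonal f := by
  apply pullback.hom_ext
  · simp [prodMap_fst]
  · simp [prodMap_snd]

theorem preimage_range_diagonal (V : Y.Opens) :
    prodMap f V ⁻¹' Set.range (pullback.diagonal f) =
      Set.range (pullback.diagonal (V.ι ≫ f)) := by
  apply Set.Subset.antisymm
  · rintro x ⟨y, hy⟩
    refine ⟨pullback.fst (V.ι ≫ f) (V.ι ≫ f) x, (prodMap f V).isOpenEmbedding.injective ?_⟩
    rw [← Scheme.Hom.comp_apply, diagonal_prodMap, Scheme.Hom.comp_apply, ← hy,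
      ← Scheme.Hom.comp_apply (pullback.fst (V.ι ≫ f) (V.ι ≫ f)), ← prodMap_fst,
      Scheme.Hom.comp_apply, ← hy, ← Scheme.Hom.comp_apply (pullback.diagonal f),
      pullback.diagonal_fst]
    rfl
  · rintro _ ⟨x, rfl⟩
    refine ⟨V.ι x, ?_⟩
    rw [← Scheme.Hom.comp_apply, ← Scheme.Hom.comp_apply, diagonal_prodMap]

variable {f} in
-- When the projections agree, `e` lies in `U × U` for an affine `U`, where the diagonal is closed.
theorem mem_range_diagonal_of_fst_eq_snd {e : (pullback f f : Scheme.{u})}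
    (he : e ∈ closure (Set.range (pullback.diagonal f)))
    (h : pullback.fst f f e = pullback.snd f f e) : e ∈ Set.range (pullback.diagonal f) := by
  obtain ⟨_, ⟨U : Y.Opens, hU, rfl⟩, hxU, -⟩ := Y.isBasis_affineOpens.exists_subset_of_mem_open
    (Set.mem_univ (pullback.fst f f e)) isOpen_univ
  have : IsAffine U := hU
  have hmem : e ∈ Set.range (prodMap f U) := by
    rw [prodMap, Scheme.Pullback.range_map]
    refine ⟨?_, ?_⟩
    · simpa using hxU
    · simpa [← h] using hxU
  obtain ⟨e, rfl⟩ := hmem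
  have h1 : e ∈ closure (prodMap f U ⁻¹' Set.range (pullback.diagonal f)) :=
    (prodMap f U).isOpenEmbedding.isOpenMap.preimage_closure_subset_closure_preimage he
  rw [preimage_range_diagonal,
    (pullback.diagonal (U.ι ≫ f)).isClosedEmbedding.isClosed_range.closure_eq,
    ← preimage_range_diagonal] at h1
  exact h1

variable [IsIntegral Y]

theorem stalkMap_of_eq_id {X : Scheme.{u}} {q : X ⟶ X} (hq : q = 𝟙 X) (x : X) :
    q.stalkMap x =
      X.presheaf.stalkSpecializes (Inseparable.of_eq (by rw [hq]; rfl : x = q x)).specializes := by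
  subst hq
  rw [Scheme.Hom.stalkMap_id]
  exact (X.presheaf.stalkSpecializes_refl x).symm

variable {f} in
-- Since `e` is a specialisation of the generic point of the diagonal, its local ring maps to the
-- function field; let `S` be the image. It dominates the local ring at `q e`. Stating this for
-- every retraction `q` of the diagonal gives one `S` for both projections.
theorem exists_subring_of_mem_closure {e : (pullback f f : Scheme.{u})}
    (he : e ∈ closure (Set.range (pullback.diagonal f))) :
    ∃ S : Subring Y.functionField, ∀ q : pullback f f ⟶ Y, pullback.diagonal f ≫ q = 𝟙 Y →
      stalkRange (q e) ≤ S ∧ ∀ a ∈ stalkRange (q e), a⁻¹ ∈ S → a ≠ 0 →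
        a⁻¹ ∈ stalkRange (q e) := by
  set d := pullback.diagonal f
  have hsp : d (genericPoint Y) ⤳ e := by
    rw [specializes_iff_mem_closure]
    have : Set.range d ⊆ closure {d (genericPoint Y)} := by
      rintro _ ⟨y, rfl⟩
      exact ((genericPoint_specializes y).map d.continuous).mem_closure
    exact closure_minimal this isClosed_closure he
  let χ := (pullback f f).presheaf.stalkSpecializes hsp ≫ d.stalkMap (genericPoint Y)
  refine ⟨χ.hom.range, fun q hq => ?_⟩
  have hχ : ∀ a, χ (q.stalkMap e a) = algebraMap (Y.presheaf.stalk (q e)) Y.functionField a := by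
    intro a
    have h1 : q.stalkMap e ≫ χ =
        Y.presheaf.stalkSpecializes (genericPoint_specializes (q e)) := by
      simp only [χ]
      rw [← Scheme.Hom.stalkSpecializes_stalkMap_assoc, ← Scheme.Hom.stalkMap_comp,
        stalkMap_of_eq_id hq]
      exact TopCat.Presheaf.stalkSpecializes_comp _ _ _
    exact ConcreteCategory.congr_hom h1 a
  refine ⟨?_, ?_⟩
  · rintro _ ⟨a, rfl⟩
    exact ⟨_, hχ a⟩
  · rintro _ ⟨a, rfl⟩ ⟨s, hs⟩ ha0
    have h1 : χ (s * q.stalkMap e a) = 1 := by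
      rw [map_mul, hχ]
      refine (congrArg (· * _) hs).trans (inv_mul_cancel₀ ha0)
    have h2 : IsUnit (s * q.stalkMap e a) := by
      -- The map `χ` need not be injective, but the local ring at `e` is local: a nonunit `u` with
      -- `χ u = 1` would make `1 - u` a unit sent to `0`.
      by_contra hn
      have h3 := IsLocalRing.isUnit_one_sub_self_of_mem_nonunits _ hn
      have h4 := h3.map χ.hom
      have h5 : χ (1 - s * q.stalkMap e a) = 0 := by rw [map_sub, h1, map_one, sub_self]
      exact h4.ne_zero h5
    have h3 : IsUnit a := isUnit_of_map_unit (q.stalkMap e).hom a (isUnit_of_mul_isUnit_right h2)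
    refine ⟨↑h3.unit⁻¹, eq_inv_of_mul_eq_one_left ?_⟩
    rw [← map_mul, IsUnit.val_inv_mul, map_one]

variable {f} in
-- Valuation rings are maximal for domination, so both local rings equal the common subring `S` that
-- dominates them.
theorem stalkRange_eq_of_mem_closure [IsLocallyNoetherian Y] [IsNormal Y]
    {e : (pullback f f : Scheme.{u})} (he : e ∈ closure (Set.range (pullback.diagonal f)))
    (h1 : coheight (pullback.fst f f e) ≤ 1) (h2 : coheight (pullback.snd f f e) ≤ 1) :
    stalkRange (pullback.fst f f e) = stalkRange (pullback.snd f f e) := by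
  obtain ⟨S, hS⟩ := exists_subring_of_mem_closure he
  have key : ∀ q : pullback f f ⟶ Y, pullback.diagonal f ≫ q = 𝟙 Y → coheight (q e) ≤ 1 →
      stalkRange (q e) = S := by
    intro q hq hco
    obtain ⟨hle, hdom⟩ := hS q hq
    refine le_antisymm hle fun g hg => ?_
    by_cases hg0 : g = 0
    · rw [hg0]; exact zero_mem _
    rcases mem_or_inv_mem_stalkRange hco g with h | h
    · exact h
    · have := hdom g⁻¹ h (by rwa [inv_inv]) (inv_ne_zero hg0)
      rwa [inv_inv] at this
  rw [key _ (pullback.diagonal_fst f) h1, key _ (pullback.diagonal_snd f) h2]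

open Classical in
-- The set `closure Δ \ Δ` is closed since the diagonal is locally closed. For each of its finitely
-- many components, delete the closure of a projection `t` of the generic point. A bad point of `Z ×
-- Z` would specialise one of these generic points and thus project into a deleted set.
theorem exists_isSeparated_open [IsLocallyNoetherian Y] [IsNormal Y]
    [TopologicalSpace.NoetherianSpace (pullback f f : Scheme.{u})] :
    ∃ Z : Y.Opens, IsSeparated (Z.ι ≫ f) ∧ genericPoint Y ∈ Z ∧
      ∀ y : Y, coheight y = 1 → ∃ z ∈ Z, stalkRange z = stalkRange y := by
  set d := pullback.diagonal f
  have hC : IsClosed (coborder (Set.range d))ᶜ :=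
    isClosed_compl_iff.mpr d.isLocallyClosed_range.isOpen_coborder
  have hCmem : ∀ e, e ∈ (coborder (Set.range d))ᶜ ↔ e ∈ closure (Set.range d) ∧
      e ∉ Set.range d := by
    intro e
    rw [coborder, compl_compl]
    rfl
  obtain ⟨F, hF, hirr, hCF⟩ :=
    TopologicalSpace.NoetherianSpace.exists_finite_set_isClosed_irreducible hC
  have hirr' := hCF.1
  replace hCF := hCF.2
  have hgen : ∀ T : F, ∃ e, IsGenericPoint e (T : Set (pullback f f : Scheme.{u})) :=
    fun T => QuasiSober.sober (hirr' T T.2) (hirr T T.2)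
  choose e he using hgen
  have heC : ∀ T, e T ∈ closure (Set.range d) ∧ e T ∉ Set.range d := by
    intro T
    rw [← hCmem, hCF]
    exact ⟨T, T.2, (he T).mem⟩
  -- Take `t` of codimension `> 1` if possible. Otherwise the two projections are distinct with
  -- equal local rings, so at most one of them is the chosen representative `stalkRep`, and `t` is
  -- one that is not.
  have ht : ∀ T : F, ∃ t : Y, (t = pullback.fst f f (e T) ∨ t = pullback.snd f f (e T)) ∧
      (1 < coheight t ∨ stalkRep t ≠ t) := by
    intro T
    by_cases h1 : 1 < coheight (pullback.fst f f (e T))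
    · exact ⟨_, Or.inl rfl, Or.inl h1⟩
    by_cases h2 : 1 < coheight (pullback.snd f f (e T))
    · exact ⟨_, Or.inr rfl, Or.inl h2⟩
    have hne : pullback.fst f f (e T) ≠ pullback.snd f f (e T) :=
      fun h => (heC T).2 (mem_range_diagonal_of_fst_eq_snd (heC T).1 h)
    have heq := stalkRep_eq_of_stalkRange_eq
      (stalkRange_eq_of_mem_closure (heC T).1 (not_lt.mp h1) (not_lt.mp h2))
    by_cases h3 : stalkRep (pullback.fst f f (e T)) = pullback.fst f f (e T)
    · refine ⟨_, Or.inr rfl, Or.inr ?_⟩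
      rw [← heq, h3]
      exact hne
    · exact ⟨_, Or.inl rfl, Or.inr h3⟩
  choose t ht ht' using ht
  have : Finite F := hF
  let Z : Y.Opens := ⟨(⋃ T : F, closure {t T})ᶜ, by
    rw [isOpen_compl_iff]
    exact isClosed_iUnion_of_finite fun _ => isClosed_closure⟩
  have hZ : ∀ z, (∀ T : F, ¬ t T ⤳ z) → z ∈ Z := by
    intro z hz hz'
    obtain ⟨T, hT⟩ := Set.mem_iUnion.mp hz'
    exact hz T (specializes_iff_mem_closure.mpr hT)
  have htη : ∀ T, t T ≠ genericPoint Y := by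
    intro T hT
    have := ht' T
    rw [hT, stalkRep_genericPoint, coheight_genericPoint] at this
    simp at this
  refine ⟨Z, ⟨?_⟩, ?_, ?_⟩
  · refine IsClosedImmersion.of_isPreimmersion _ (isClosed_of_closure_subset fun x hx => ?_)
    rw [← preimage_range_diagonal] at hx ⊢
    have hx' : prodMap f Z x ∈ closure (Set.range d) :=
      (prodMap f Z).continuous.closure_preimage_subset _ hx
    by_contra hxd
    have hmem : prodMap f Z x ∈ (coborder (Set.range d))ᶜ := (hCmem _).mpr ⟨hx', hxd⟩
    rw [hCF] at hmem
    obtain ⟨T, hT, hxT⟩ := hmem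
    have hsp := (he ⟨T, hT⟩).specializes hxT
    have hfst : t ⟨T, hT⟩ ⤳ pullback.fst f f (prodMap f Z x) ∨
        t ⟨T, hT⟩ ⤳ pullback.snd f f (prodMap f Z x) := by
      rcases ht ⟨T, hT⟩ with h | h
      · left; rw [h]; exact hsp.map (pullback.fst f f).continuous
      · right; rw [h]; exact hsp.map (pullback.snd f f).continuous
    rw [← Scheme.Hom.comp_apply, ← Scheme.Hom.comp_apply, prodMap_fst, prodMap_snd] at hfst
    have hnot : ∀ z : (Z : Scheme.{u}), ¬ t ⟨T, hT⟩ ⤳ Z.ι z := by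
      intro z hz
      exact z.2 (Set.mem_iUnion.mpr ⟨_, hz.mem_closure⟩)
    rcases hfst with h | h
    · exact hnot _ h
    · exact hnot _ h
  · refine hZ _ fun T hT => htη T ?_
    exact hT.antisymm (genericPoint_specializes _) |>.eq
  · intro y hy
    have hy' : coheight (stalkRep y) = 1 := by
      rw [coheight_eq_of_stalkRange_eq (stalkRange_stalkRep y), hy]
    -- A deleted closure containing this representative would have it as generic point, against the
    -- choice of `t T`.
    refine ⟨stalkRep y, hZ _ fun T hT => ?_, stalkRange_stalkRep y⟩
    have := eq_of_specializes_of_coheight_eq_one hT hy' (htη T)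
    have h := ht' T
    rw [this, hy', stalkRep_eq_of_stalkRange_eq (stalkRange_stalkRep y)] at h
    simp at h

end Diagonal

/-! ### Spreading out morphisms from local rings -/

section SpreadingOut

variable {Y : Scheme.{u}} [IsIntegral Y]

theorem genericPoint_mem {V : Y.Opens} {y : Y} (hy : y ∈ V) : genericPoint Y ∈ V :=
  (genericPoint_specializes y).mem_open V.isOpen hy

theorem dense_of_genericPoint_mem {V : Y.Opens} (hV : genericPoint Y ∈ V) :
    Dense (V : Set Y) := fun _ =>
  ((genericPoint_specializes _).mem_closure : _ ∈ closure {genericPoint Y}) |>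
    closure_mono (Set.singleton_subset_iff.mpr hV)

/-- The morphism `Spec K(Y) → V` for a nonempty open subscheme `V` of `Y`. -/
noncomputable def genericMap (V : Y.Opens) (hV : genericPoint Y ∈ V) :
    Spec Y.functionField ⟶ V :=
  V.fromSpecStalkOfMem (genericPoint Y) hV

theorem genericMap_ι (V : Y.Opens) (hV : genericPoint Y ∈ V) :
    genericMap V hV ≫ V.ι = Y.fromSpecStalk (genericPoint Y) :=
  V.fromSpecStalkOfMem_ι _ hV

theorem genericMap_homOfLE {V W : Y.Opens} (h : V ≤ W) (hV : genericPoint Y ∈ V) :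
    genericMap V hV ≫ Y.homOfLE h = genericMap W (h hV) := by
  rw [← cancel_mono W.ι, Category.assoc, Scheme.homOfLE_ι, genericMap_ι, genericMap_ι]

theorem SpecMap_stalkSpecializes_fromSpecStalkOfMem (V : Y.Opens) {y : Y} (hy : y ∈ V) :
    Spec.map (Y.presheaf.stalkSpecializes (genericPoint_specializes y)) ≫
      V.fromSpecStalkOfMem y hy = genericMap V (genericPoint_mem hy) := by
  rw [← cancel_mono V.ι, Category.assoc, Scheme.Opens.fromSpecStalkOfMem_ι, genericMap_ι,
    Scheme.SpecMap_stalkSpecializes_fromSpecStalk]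

/-- The closed point of the spectrum of a local ring of a scheme. -/
noncomputable def stalkClosedPoint (y : Y) : (Spec (Y.presheaf.stalk y) : Scheme.{u}) :=
  IsLocalRing.closedPoint (Y.presheaf.stalk y)

theorem fromSpecStalk_stalkClosedPoint {Y : Scheme.{u}} (y : Y) : Y.fromSpecStalk y (stalkClosedPoint y) = y :=
  Scheme.fromSpecStalk_closedPoint

theorem fromSpecStalkOfMem_stalkClosedPoint {Y : Scheme.{u}} (V : Y.Opens) {y : Y} (hy : y ∈ V) :
    V.fromSpecStalkOfMem y hy (stalkClosedPoint y) = ⟨y, hy⟩ := by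
  apply V.ι.isOpenEmbedding.injective
  rw [← Scheme.Hom.comp_apply, Scheme.Opens.fromSpecStalkOfMem_ι]
  exact fromSpecStalk_stalkClosedPoint y

instance isDominant_genericMap (V : Y.Opens) (hV : genericPoint Y ∈ V) :
    IsDominant (genericMap V hV) := by
  constructor
  intro x
  have h : (⟨genericPoint Y, hV⟩ : (V : Scheme.{u})) ∈ Set.range (genericMap V hV) :=
    ⟨_, fromSpecStalkOfMem_stalkClosedPoint V hV⟩
  have hs : (⟨genericPoint Y, hV⟩ : (V : Scheme.{u})) ⤳ x :=
    V.ι.isOpenEmbedding.isInducing.specializes_iff.mp (genericPoint_specializes _)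
  exact closure_mono (Set.singleton_subset_iff.mpr h) hs.mem_closure

theorem fromFunctionField_eq {Z : Scheme.{u}} (g : Y.PartialMap Z) {y : Y} (hy : y ∈ g.domain) :
    Spec.map (Y.presheaf.stalkSpecializes (genericPoint_specializes y)) ≫
      g.fromSpecStalkOfMem hy = genericMap g.domain (genericPoint_mem hy) ≫ g.hom := by
  rw [Scheme.PartialMap.fromSpecStalkOfMem, ← Category.assoc,
    SpecMap_stalkSpecializes_fromSpecStalkOfMem]

/-- The morphism between the local rings at two points with the same local ring inside the function
field. -/
noncomputable def stalkIsoOfEq {y z : Y} (h : stalkRange z = stalkRange y) :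
    Y.presheaf.stalk z ≅ Y.presheaf.stalk y :=
  (stalkEquivOfEq h).toCommRingCatIso

theorem stalkIsoOfEq_hom_stalkSpecializes {y z : Y} (h : stalkRange z = stalkRange y) :
    (stalkIsoOfEq h).hom ≫ Y.presheaf.stalkSpecializes (genericPoint_specializes y) =
      Y.presheaf.stalkSpecializes (genericPoint_specializes z) := by
  ext a
  exact algebraMap_stalkEquivOfEq h a

theorem eq_of_SpecMap_stalkSpecializes_comp_eq {R : CommRingCat.{u}} {y : Y}
    {a b : Spec (Y.presheaf.stalk y) ⟶ Spec R}
    (h : Spec.map (Y.presheaf.stalkSpecializes (genericPoint_specializes y)) ≫ a =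
      Spec.map (Y.presheaf.stalkSpecializes (genericPoint_specializes y)) ≫ b) : a = b := by
  have hinj : Function.Injective
      (Y.presheaf.stalkSpecializes (genericPoint_specializes y)) :=
    IsFractionRing.injective (Y.presheaf.stalk y) Y.functionField
  have := ConcreteCategory.mono_of_injective _ hinj
  rw [← Spec.map_preimage a, ← Spec.map_preimage b, ← Spec.map_comp, ← Spec.map_comp] at h
  have h' := (cancel_mono _).mp (Spec.map_injective h)
  rw [← Spec.map_preimage a, ← Spec.map_preimage b, h']

/-- The identification of the two local rings gives `Spec 𝒪_y → V` over the base, as may be checked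
at the generic point. Finite type extends it to a neighbourhood of `y`. -/
theorem exists_partialMap_of_stalkRange_eq {R : CommRingCat.{u}} (f : Y ⟶ Spec R)
    [LocallyOfFiniteType f] {y z : Y} (h : stalkRange z = stalkRange y)
    (V : Y.Opens) (hz : z ∈ V) : ∃ (g : Y.PartialMap V) (hy : y ∈ g.domain),
      V.ι (g.hom ⟨y, hy⟩) = z ∧ genericMap g.domain (genericPoint_mem hy) ≫ g.hom =
        genericMap V (genericPoint_mem hz) := by
  let φ := Spec.map (stalkIsoOfEq h).hom ≫ V.fromSpecStalkOfMem z hz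
  have hφ : Spec.map (Y.presheaf.stalkSpecializes (genericPoint_specializes y)) ≫ φ =
      genericMap V (genericPoint_mem hz) := by
    rw [← Category.assoc, ← Spec.map_comp, stalkIsoOfEq_hom_stalkSpecializes,
      SpecMap_stalkSpecializes_fromSpecStalkOfMem]
  have hcomp : φ ≫ V.ι ≫ f = Y.fromSpecStalk y ≫ f := by
    apply eq_of_SpecMap_stalkSpecializes_comp_eq
    rw [← Category.assoc, hφ, ← Category.assoc, genericMap_ι, ← Category.assoc,
      Scheme.SpecMap_stalkSpecializes_fromSpecStalk]
  obtain ⟨g, hy, hg⟩ : ∃ (g : Y.PartialMap V) (hy : y ∈ g.domain),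
      g.fromSpecStalkOfMem hy = φ :=
    ⟨.ofFromSpecStalk f (V.ι ≫ f) φ hcomp,
      Scheme.PartialMap.mem_domain_ofFromSpecStalk f (V.ι ≫ f) φ hcomp,
      Scheme.PartialMap.fromSpecStalkOfMem_ofFromSpecStalk f (V.ι ≫ f) φ hcomp⟩
  refine ⟨g, hy, ?_, ?_⟩
  · rw [← fromSpecStalkOfMem_stalkClosedPoint, ← Scheme.Hom.comp_apply, ← Scheme.Hom.comp_apply]
    have h2 : (g.domain.fromSpecStalkOfMem y hy ≫ g.hom) ≫ V.ι =
        Spec.map (stalkIsoOfEq h).hom ≫ Y.fromSpecStalk z := by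
      have : g.domain.fromSpecStalkOfMem y hy ≫ g.hom = φ := hg
      rw [this, Category.assoc, Scheme.Opens.fromSpecStalkOfMem_ι]
    rw [← Category.assoc, h2, Scheme.Hom.comp_apply]
    have h3 : Spec.map (stalkIsoOfEq h).hom (stalkClosedPoint y) = stalkClosedPoint z :=
      IsLocalRing.comap_closedPoint (stalkIsoOfEq h).hom.hom
    rw [h3, fromSpecStalk_stalkClosedPoint]
  · rw [← fromFunctionField_eq g hy, hg, hφ]

end SpreadingOut

section OpenImmersion

/-- An immersion is a closed immersion into the open coborder of its range. When dominant, this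
closed immersion is surjective onto a reduced scheme, hence an isomorphism. -/
theorem isOpenImmersion_of_isImmersion_of_isDominant {X Y : Scheme.{u}} (f : X ⟶ Y)
    [IsImmersion f] [IsDominant f] [IsReduced Y] : IsOpenImmersion f := by
  have h := f.liftCoborder_ι
  have hdom : Dense (Set.range f.liftCoborder) := by
    have h1 : f.coborderRange.ι ⁻¹' closure (Set.range f) ⊆
        closure (f.coborderRange.ι ⁻¹' Set.range f) :=
      f.coborderRange.ι.isOpenEmbedding.isOpenMap.preimage_closure_subset_closure_preimage
    have h2 : f.coborderRange.ι ⁻¹' Set.range f = Set.range f.liftCoborder := by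
      ext x
      constructor
      · rintro ⟨y, hy⟩
        refine ⟨y, f.coborderRange.ι.isOpenEmbedding.injective ?_⟩
        rw [← Scheme.Hom.comp_apply, h, hy]
      · rintro ⟨y, rfl⟩
        refine ⟨y, ?_⟩
        rw [← Scheme.Hom.comp_apply, h]
    rw [h2, (‹IsDominant f›.denseRange).closure_range] at h1
    exact fun x => h1 (Set.mem_univ _)
  have hsurj : Surjective f.liftCoborder := by
    constructor
    rw [← Set.range_eq_univ, ← hdom.closure_eq]
    exact (f.liftCoborder.isClosedEmbedding.isClosed_range.closure_eq).symm
  have := isIso_of_isClosedImmersion_of_surjective f.liftCoborder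
  rw [← h]
  infer_instance

end OpenImmersion

theorem homOfLE_comp_apply {X W : Scheme.{u}} {V V' : X.Opens} (h : V ≤ V')
    (g : (V' : Scheme.{u}) ⟶ W) {x : X} (hx : x ∈ V) :
    (X.homOfLE h ≫ g) ⟨x, hx⟩ = g ⟨x, h hx⟩ :=
  (Scheme.Hom.comp_apply _ _ _).trans
    (congrArg g (Subtype.ext (Scheme.homOfLE_apply h ⟨x, hx⟩)))

/-! ### Extending the identity of an open subscheme -/

section Extension

variable {Y : Scheme.{u}} [IsIntegral Y] {Z : Y.Opens}

/-- The partial map `s : Y ⇢ Z` to an open subscheme of `Y` is the identity generically. -/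
def IsGenericIdentity (s : Y.PartialMap Z) : Prop :=
  ∃ (h : genericPoint Y ∈ s.domain) (h' : genericPoint Y ∈ Z),
    genericMap s.domain h ≫ s.hom = genericMap Z h'

theorem IsGenericIdentity.equiv {s t : Y.PartialMap Z} (hs : IsGenericIdentity s)
    (ht : IsGenericIdentity t) : s.equiv t := by
  obtain ⟨hs, _, e⟩ := hs
  obtain ⟨ht, _, e'⟩ := ht
  exact Scheme.PartialMap.equiv_of_fromSpecStalkOfMem_eq s t hs ht (e.trans e'.symm)

theorem isGenericIdentity_id (hZ : genericPoint Y ∈ Z) :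
    IsGenericIdentity ⟨Z, dense_of_genericPoint_mem hZ, 𝟙 (Z : Scheme.{u})⟩ :=
  ⟨hZ, hZ, Category.comp_id _⟩

/-- Into a separated scheme from a reduced one, a rational map has a largest domain of definition,
which absorbs every representative. -/
theorem exists_maximal_isGenericIdentity [(Z : Scheme.{u}).IsSeparated]
    (hZ : genericPoint Y ∈ Z) : ∃ s : Y.PartialMap Z, IsGenericIdentity s ∧
      ∀ t : Y.PartialMap Z, IsGenericIdentity t →
        ∃ h : t.domain ≤ s.domain, Y.homOfLE h ≫ s.hom = t.hom := by
  let i : Y.PartialMap Z := ⟨Z, dense_of_genericPoint_mem hZ, 𝟙 (Z : Scheme.{u})⟩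
  have hi : IsGenericIdentity i := isGenericIdentity_id hZ
  have hmax : ∀ t : Y.PartialMap Z, IsGenericIdentity t →
      ∃ h : t.domain ≤ i.toRationalMap.toPartialMap.domain,
        Y.homOfLE h ≫ i.toRationalMap.toPartialMap.hom = t.hom := by
    intro t ht
    rw [← Scheme.PartialMap.toRationalMap_eq_iff.mpr (ht.equiv hi)]
    exact ⟨t.le_domain_toRationalMap, t.toPartialMap_toRationalMap_restrict⟩
  refine ⟨i.toRationalMap.toPartialMap, ?_, hmax⟩
  obtain ⟨h, hh⟩ := hmax i hi
  refine ⟨h hZ, hZ, ?_⟩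
  rw [← genericMap_homOfLE h hZ, Category.assoc, hh]
  exact Category.comp_id _

theorem IsGenericIdentity.comp_eq {s : Y.PartialMap Z} (hs : IsGenericIdentity s)
    {B : Scheme.{u}} [B.IsSeparated] (f : Y ⟶ B) : s.hom ≫ Z.ι ≫ f = s.domain.ι ≫ f := by
  obtain ⟨h, h', e⟩ := hs
  refine ext_of_isDominant (genericMap s.domain h) ?_
  rw [← Category.assoc, e, ← Category.assoc, genericMap_ι, ← Category.assoc, genericMap_ι]

/-- Spreading out in the opposite direction gives a partial map `g` near `s y` with values in an
affine neighbourhood `A` of `y`. Near `y` the composite of `s` and `g` is the inclusion into `A`, by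
comparison at the generic point. So `s` is there an immersion, and being dominant, an open one. -/
theorem IsGenericIdentity.exists_isOpenImmersion {R : CommRingCat.{u}} (f : Y ⟶ Spec R)
    [LocallyOfFiniteType f] {s : Y.PartialMap Z} (hs : IsGenericIdentity s) {y : Y}
    (hy : y ∈ s.domain) (h : stalkRange (Z.ι (s.hom ⟨y, hy⟩)) = stalkRange y) :
    ∃ (V : Y.Opens) (hV : V ≤ s.domain), y ∈ V ∧ IsOpenImmersion (Y.homOfLE hV ≫ s.hom) := by
  obtain ⟨A, hA, hyA, -⟩ := exists_isAffineOpen_mem_and_subset (U := ⊤) (x := y) trivial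
  have : IsAffine (A : Scheme.{u}) := hA
  obtain ⟨g, hz, -, hg⟩ := exists_partialMap_of_stalkRange_eq f h.symm A hyA
  obtain ⟨hη, hηZ, e⟩ := hs
  let V : Y.Opens := A ⊓ s.domain.ι ''ᵁ (s.hom ⁻¹ᵁ (Z.ι ⁻¹ᵁ g.domain))
  have hVs : V ≤ s.domain := by
    rintro x ⟨-, x, -, rfl⟩
    exact x.2
  have hyV : y ∈ V := ⟨hyA, ⟨y, hy⟩, hz, rfl⟩
  have hrange : Set.range (Y.homOfLE hVs ≫ s.hom ≫ Z.ι) ⊆ Set.range g.domain.ι := by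
    rintro _ ⟨⟨x, hxV⟩, rfl⟩
    obtain ⟨a, ha, rfl⟩ := id hxV.2
    rw [Scheme.Opens.range_ι]
    exact (congrArg (· ∈ g.domain) (homOfLE_comp_apply hVs (s.hom ≫ Z.ι) hxV)).mpr ha
  let t : (V : Scheme.{u}) ⟶ g.domain := IsOpenImmersion.lift g.domain.ι _ hrange
  have ht : t ≫ g.domain.ι = Y.homOfLE hVs ≫ s.hom ≫ Z.ι := IsOpenImmersion.lift_fac _ _ hrange
  have hηV := genericPoint_mem hyV
  have htη : genericMap V hηV ≫ t = genericMap g.domain (genericPoint_mem hz) := by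
    rw [← cancel_mono g.domain.ι, Category.assoc, ht, ← Category.assoc, genericMap_homOfLE,
      ← Category.assoc, e, genericMap_ι, genericMap_ι]
  have htg : t ≫ g.hom = Y.homOfLE (inf_le_left : V ≤ A) := by
    refine ext_of_isDominant (genericMap V hηV) ?_
    rw [← Category.assoc, htη, hg, genericMap_homOfLE]
  have : IsImmersion (t ≫ g.hom) := htg ▸ inferInstance
  have : IsImmersion t := .of_comp t g.hom
  have : IsDominant (genericMap V hηV ≫ t) := htη ▸ inferInstance
  have : IsDominant t := .of_comp (genericMap V hηV) t
  have := isOpenImmersion_of_isImmersion_of_isDominant t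
  have : IsOpenImmersion ((Y.homOfLE hVs ≫ s.hom) ≫ Z.ι) := by
    rw [Category.assoc, ← ht]
    infer_instance
  exact ⟨V, hVs, hyV, .of_comp _ Z.ι⟩

/-- The open subset of the points near which a partial map is an open immersion. -/
def openImmersionLocus {Y W : Scheme.{u}} (s : Y.PartialMap W) : Y.Opens :=
  sSup {V | ∃ hV : V ≤ s.domain, IsOpenImmersion (Y.homOfLE hV ≫ s.hom)}

theorem openImmersionLocus_le {Y W : Scheme.{u}} (s : Y.PartialMap W) :
    openImmersionLocus s ≤ s.domain :=
  sSup_le fun _ hV => hV.1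

theorem isLocalIso_homOfLE_openImmersionLocus {Y W : Scheme.{u}} (s : Y.PartialMap W) :
    IsLocalIso (Y.homOfLE (openImmersionLocus_le s) ≫ s.hom) := by
  constructor
  intro x
  obtain ⟨(V : Y.Opens), hV, hx⟩ := TopologicalSpace.Opens.mem_sSup.mp x.2
  obtain ⟨hVs, hVo⟩ := id hV
  have hle : V ≤ openImmersionLocus s := le_sSup hV
  refine ⟨(openImmersionLocus s).ι ⁻¹ᵁ V, hx, ?_⟩
  have hrange : Set.range (((openImmersionLocus s).ι ⁻¹ᵁ V).ι ≫ (openImmersionLocus s).ι) ⊆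
      Set.range V.ι := by
    rintro _ ⟨a, rfl⟩
    rw [Scheme.Opens.range_ι]
    exact a.2
  let t := IsOpenImmersion.lift V.ι _ hrange
  have ht : t ≫ V.ι = _ := IsOpenImmersion.lift_fac _ _ hrange
  have h : ((openImmersionLocus s).ι ⁻¹ᵁ V).ι ≫ Y.homOfLE (openImmersionLocus_le s) =
      t ≫ Y.homOfLE hVs := by
    rw [← cancel_mono s.domain.ι, Category.assoc, Category.assoc, Scheme.homOfLE_ι,
      Scheme.homOfLE_ι, ht]
  have : IsOpenImmersion (t ≫ V.ι) := ht ▸ inferInstance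
  have : IsOpenImmersion t := .of_comp t V.ι
  rw [← Category.assoc, h, Category.assoc]
  infer_instance

end Extension

/-- The target is the separated open `Z ⊆ Y`, and `s` is the maximal extension of its identity,
restricted to the locus where it is locally an open immersion. -/
theorem exists_isSeparation (k : Type u) [Field k] (Y : Scheme.{u}) [Y.Over (Spec (.of k))]
    [IsIntegral Y] [IsNormal Y] [LocallyOfFiniteType (Y ↘ Spec (.of k))]
    [QuasiCompact (Y ↘ Spec (.of k))] :
    ∃ (Ysep : Scheme.{u}) (_ : Ysep.Over (Spec (.of k))) (s : Y.PartialMap Ysep),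
        IsIntegral Ysep ∧ FSep.IsNormal Ysep ∧ LocallyOfFiniteType (Ysep ↘ Spec (.of k)) ∧
          QuasiCompact (Ysep ↘ Spec (.of k)) ∧ FSep.IsSeparation k s := by
  let f := Y ↘ Spec (.of k)
  have : LocallyOfFiniteType f := ‹_›
  have : IsLocallyNoetherian Y := LocallyOfFiniteType.isLocallyNoetherian f
  have : CompactSpace Y := QuasiCompact.compactSpace_of_compactSpace f
  have : IsNoetherian Y := {}
  have : IsNoetherian (Limits.pullback f f) := {}
  obtain ⟨Z, hsep, hZ, hZY⟩ := exists_isSeparated_open f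
  have : Nonempty (Z : Scheme.{u}) := ⟨⟨_, hZ⟩⟩
  have : (Z : Scheme.{u}).IsSeparated := ⟨by
    rw [← Limits.terminal.comp_from (Z.ι ≫ f)]
    infer_instance⟩
  obtain ⟨s, hs, hmax⟩ := exists_maximal_isGenericIdentity hZ
  obtain ⟨hZs, hid⟩ := hmax _ (isGenericIdentity_id hZ)
  have hZU : Z ≤ openImmersionLocus s := le_sSup ⟨hZs, hid ▸ inferInstance⟩
  have hη := hZU hZ
  refine ⟨Z, inferInstance, s.restrict _ (dense_of_genericPoint_mem hη) (openImmersionLocus_le s),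
    inferInstance, inferInstance, inferInstanceAs (LocallyOfFiniteType (Z.ι ≫ f)),
    inferInstanceAs (QuasiCompact (Z.ι ≫ f)), ?_, hsep, ?_,
    isLocalIso_homOfLE_openImmersionLocus s, ?_⟩
  · have : s.IsOver (Spec (.of k)) := ⟨hs.comp_eq f⟩
    infer_instance
  · intro y hy
    by_contra! hc
    refine hy ?_
    rcases hc.lt_or_eq with hc | hc
    · rw [eq_genericPoint_of_coheight_eq_zero (Order.lt_one_iff.mp hc)]
      exact hη
    -- The partner `z ∈ Z` with the same local ring yields a partial map sending `y` to `z`. By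
    -- maximality `s` extends it, and equality of local rings makes `s` an open immersion near `y`.
    · obtain ⟨z, hz, hzy⟩ := hZY y hc
      obtain ⟨g, hyg, hgz, hg⟩ := exists_partialMap_of_stalkRange_eq f hzy Z hz
      obtain ⟨hle, e⟩ := hmax g ⟨_, _, hg⟩
      have hsy : Z.ι (s.hom ⟨y, hle hyg⟩) = z := by
        rw [← hgz, ← e]
        exact congrArg Z.ι (homOfLE_comp_apply hle s.hom hyg).symm
      obtain ⟨V, hV, hyV, hVo⟩ := hs.exists_isOpenImmersion f (hle hyg) (hsy ▸ hzy)
      exact TopologicalSpace.Opens.mem_sSup.mpr ⟨V, ⟨hV, hVo⟩, hyV⟩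
  -- The image is all of `Z`, on which `s` is the identity.
  · intro z hz
    refine absurd ⟨Y.homOfLE hZU z, ?_⟩ hz
    change (Y.homOfLE hZU ≫ Y.homOfLE (openImmersionLocus_le s) ≫ s.hom) z = z
    rw [← Category.assoc, Scheme.homOfLE_homOfLE, hid]
    rfl

end FSep

theorem mainTheorem4 (k : Type u) [Field k] [IsAlgClosed k] :
    -- every normal prevariety admits a separation by a normal variety
    (∀ (Y : Scheme.{u}) [Y.Over (Spec (.of k))] [IsIntegral Y] [FSep.IsNormal Y]
        [LocallyOfFiniteType (Y ↘ Spec (.of k))] [QuasiCompact (Y ↘ Spec (.of k))],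
      ∃ (Ysep : Scheme.{u}) (_ : Ysep.Over (Spec (.of k))) (s : Y.PartialMap Ysep),
        IsIntegral Ysep ∧ FSep.IsNormal Ysep ∧ LocallyOfFiniteType (Ysep ↘ Spec (.of k)) ∧
          QuasiCompact (Ysep ↘ Spec (.of k)) ∧ FSep.IsSeparation k s) ∧
    -- comparison of Frobenius splittings; over a field, a scheme is of finite type if and only if
    -- it is locally of finite type and Noetherian
    (∀ (p : ℕ) [Fact p.Prime] [CharP k p]
        (Y : Scheme.{u}) [Y.Over (Spec (.of k))] [IsIntegral Y] [FSep.IsNormal Y]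
        [LocallyOfFiniteType (Y ↘ Spec (.of k))] [AlgebraicGeometry.IsNoetherian Y]
        (Ysep : Scheme.{u}) [Ysep.Over (Spec (.of k))] [IsIntegral Ysep] [FSep.IsNormal Ysep]
        [LocallyOfFiniteType (Ysep ↘ Spec (.of k))] [AlgebraicGeometry.IsNoetherian Ysep]
        (s : Y.PartialMap Ysep) (_ : FSep.IsSeparation k s)
        (Δ : AlgebraicCycle Y ℚ) (_ : FSep.IsDivisor Δ) (_ : ∀ y, 0 ≤ Δ y),
      (FSep.IsFSplit p Δ ↔ FSep.IsFSplit p (FSep.sMax s Δ)) ∧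
      (FSep.IsFRegular p Δ ↔ FSep.IsFRegular p (FSep.sMax s Δ)) ∧
      (∀ I : Y.IdealSheafData, FSep.domainClosure s I = I →
        (FSep.IsFSplitCompatibly p Δ I →
          FSep.IsFSplitCompatibly p (FSep.sMax s Δ) (FSep.imageClosure s I)) ∧
        ((IsReduced (FSep.imageClosure s I).subscheme → IsReduced I.subscheme) →
          FSep.HasUnnestedImages s I →
          FSep.IsFSplitCompatibly p (FSep.sMax s Δ) (FSep.imageClosure s I) →
          FSep.IsFSplitCompatibly p Δ I))) := by
  refine ⟨?_, ?_⟩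
  · intro Y _ _ _ _ _
    exact FSep.exists_isSeparation k Y
  · intro p _ _ Y _ _ _ _ _ Ysep _ _ _ _ _ s hs Δ _ hΔ
    have := hs.isLocalIso
    exact ⟨FSep.isFSplit_sMax_iff hs.isBig_domain hs.isBig_range hΔ,
      ⟨fun h => h.sMax hs.isBig_domain hs.isBig_range hΔ,
        fun h => h.of_sMax hs.isBig_domain hs.isBig_range hΔ⟩,
      fun I hI => ⟨fun h => h.sMax hs.isBig_domain hs.isBig_range hΔ,
        fun hred hnest h => h.of_sMax hs.isBig_domain hs.isBig_range hΔ hI hred hnest⟩⟩
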